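/- Let $\mathfrak g$ be a complex simple Lie algebra with Cartan subalgebra $\mathfrak h$, root set $\Pi$, positive roots $\Pi^+$ with simple system $\Sigma$, and Cartan–Killing form $(\cdot,\cdot)$. Fix a Weyl basis $X_\alpha\in\mathfrak g_\alpha$ ($\alpha\in\Pi$): $(X_\alpha,X_{-\alpha})=1$, $[X_\alpha,X_\beta]=m_{\alpha,\beta}X_{\alpha+\beta}$ for $\alpha+\beta\in\Pi$, with $m_{\alpha,\beta}\in\mathbb R$, $m_{-\alpha,-\beta}=-m_{\alpha,\beta}$. Put $A_\alpha=X_\alpha-X_{-\alpha}$, $S_\alpha=\sqrt{-1}\,(X_\alpha+X_{-\alpha})$, $\mathfrak u_\alpha=\mathrm{span}_{\mathbb R}\{A_\alpha,S_\alpha\}$, and let $\mathfrak u$ be the compact real form spanned over $\mathbb R$ by the $\sqrt{-1}H_\alpha,A_\alpha,S_\alpha$, where $(H_\alpha,\cdot)=\alpha$ on $\mathfrak h$. For $\Theta\subseteq\Sigma$ let $\langle\Theta\rangle$ be the set of roots spanned by $\Theta$, $\mathfrak p_\Theta=\mathfrak h\oplus\sum_{\alpha\in\langle\Theta\rangle\cap\Pi^-}\mathfrak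 g_\alpha\oplus\sum_{\alpha\in\Pi^+}\mathfrak g_\alpha$, $U=\exp\mathfrak u$, $K=\{k\in U:\mathrm{Ad}(k)\mathfrak p_\Theta=\mathfrak p_\Theta\}$, and let $U/K$ be the generalized flag manifold, with origin $o=eK$ and $T_o(U/K)\simeq\mathfrak m=\sum_{\alpha\in\Pi^+\setminus\langle\Theta\rangle}\mathfrak u_\alpha$. Let $Y\mapsto Y_{\mathfrak m}$ be the orthogonal projection $\mathfrak u\to\mathfrak m$. Let $\Pi(\Theta)$ be the set of those $\sigma\subseteq\Pi^+\setminus\langle\Theta\rangle$ for which $\mathfrak m_\sigma=\sum_{\alpha\in\sigma}\mathfrak u_\alpha$ is an irreducible component of the isotropy representation of $K$ on $\mathfrak m$. An invariant metric $\Lambda=(\lambda_\sigma)_{\sigma\in\Pi(\Theta)}$, $\lambda_\sigma>0$, on $U/K$ is given at $o$ by the scalar product $B_\Lambda=-\sum_\sigma\lambda_\sigma(\cdot,\cdot)|_{\mathfrak m_\sigma}$. Let $\mathcal P\subseteq\Pi(\Theta)$ and let $\Lambda^\#$ be a $\mathcal P$-perturbation of $\Lambda$: an invariant metric with $\lambda^\#_\sigma=\lambda_\sigma$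 for $\sigma\in\mathcal P$ and $\lambda^\#_\sigma=\lambda_\sigma+\xi_\sigma>0$, $\xi_\sigma\in\mathbb R$, for $\sigma\notin\mathcal P$. Let $X\in\mathfrak m$, $a>0$, and let $\gamma(t)=\exp(tX)\cdot o$, $0\le t\le a$, be subordinated to $\mathcal P$: if $\gamma'(t)=\sum_\alpha\gamma_\alpha(t)$ with $\gamma_\alpha(t)\in d(\exp tX)_o\,\mathfrak u_\alpha$, then $\gamma_\alpha=0$ whenever $\alpha\in\sigma\in\Pi(\Theta)\setminus\mathcal P$. Assume that $\gamma$ is a geodesic for both $\Lambda$ and $\Lambda^\#$. Let $q:[0,a]\to\mathfrak u$ be of class $C^{n+1}$, $0\le n\le\infty$, and let $I_\Lambda(q)=E''(0)$, where $E(s)=\int_0^a|\partial_t f(s,t)|_\Lambda^2\,dt$ is the energy of the variation $f(s,t)=\exp(s\,q(t))\cdot\gamma(t)$; similarly $I_{\Lambda^\#}(q)$. Then both energies are twice continuously differentiable near $s=0$, there are functions $\tilde f_\alpha,\tilde g_\alpha$ of class $C^n$ on $[0,a]$ with $$(\mathrm{Ad}(\exp(-tX))\,q'(t))_{\mathfrak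 m}=\sum_{\alpha\in\Pi^+\setminus\langle\Theta\rangle}\bigl(\tilde f_\alpha(t)A_\alpha+\tilde g_\alpha(t)S_\alpha\bigr),\qquad 0\le t\le a,$$ and for the functions determined by this expansion $$I_{\Lambda^\#}(q)=I_\Lambda(q)+4\sum_{\sigma\in\Pi(\Theta)\setminus\mathcal P}\xi_\sigma\sum_{\alpha\in\sigma}\int_0^a\bigl(\tilde f_\alpha(t)^2+\tilde g_\alpha(t)^2\bigr)\,dt .$$ -/

import Mathlib

open Set Filter Topology

namespace FlagPerturbation

noncomputable section

/-! ### Calculus in finite-dimensional vector spaces, in coordinates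

A Lie algebra carries no norm, so derivatives and smoothness of curves in a finite-dimensional
real vector space `V` are expressed through the coordinates, i.e. all real linear functionals. -/

/-- The curve `c` in the finite-dimensional real vector space `V` has derivative `v` at `t`
within the set `s`. -/
def HasCurveDerivWithinAt {V : Type*} [AddCommGroup V] [Module ℝ V]
    (c : ℝ → V) (v : V) (s : Set ℝ) (t : ℝ) : Prop :=
  ∀ φ : V →ₗ[ℝ] ℝ, HasDerivWithinAt (fun r => φ (c r)) (φ v) s t

/-- The curve `c` in the finite-dimensional real vector space `V` has derivative `v` at `t`. -/
def HasCurveDerivAt {V : Type*} [AddCommGroup V] [Module ℝ V]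
    (c : ℝ → V) (v : V) (t : ℝ) : Prop :=
  HasCurveDerivWithinAt c v univ t

/-- The map `c` from a normed space into the finite-dimensional real vector space `V` is of
class `C^n` on `s`. -/
def IsCnOn {E V : Type*} [NormedAddCommGroup E] [NormedSpace ℝ E] [AddCommGroup V] [Module ℝ V]
    (n : ℕ∞) (c : E → V) (s : Set E) : Prop :=
  ∀ φ : V →ₗ[ℝ] ℝ, ContDiffOn ℝ n (fun r => φ (c r)) s

/-! ### The adjoint group -/

section Exponential

variable {𝔤 : Type*} [LieRing 𝔤] [LieAlgebra ℂ 𝔤] [FiniteDimensional ℂ 𝔤]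

/-- The exponential of an endomorphism of a finite-dimensional complex vector space, computed as
the exponential of its matrix. -/
def expEnd (f : Module.End ℂ 𝔤) : Module.End ℂ 𝔤 :=
  (LinearMap.toMatrixAlgEquiv (Module.finBasis ℂ 𝔤)).symm
    (NormedSpace.exp (LinearMap.toMatrixAlgEquiv (Module.finBasis ℂ 𝔤) f))

theorem expEnd_mul_neg (f : Module.End ℂ 𝔤) : expEnd f * expEnd (-f) = 1 := by
  unfold expEnd
  set M := LinearMap.toMatrixAlgEquiv (Module.finBasis ℂ 𝔤) f with hM
  have h : NormedSpace.exp M * NormedSpace.exp (-M) = 1 := by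
    rw [← Matrix.exp_add_of_commute M (-M) (Commute.refl M).neg_right, add_neg_cancel,
      NormedSpace.exp_zero]
  rw [← map_mul, map_neg, ← hM, h, map_one]

/-- `exp x = e^{ad x}`, the exponential map `𝔤 → Int(𝔤)` into the adjoint group. Under the
adjoint representation this is also `Ad(exp x)` for the exponential of any Lie group with Lie
algebra `𝔤`. -/
def expAd (x : 𝔤) : (Module.End ℂ 𝔤)ˣ where
  val := expEnd (LieAlgebra.ad ℂ 𝔤 x)
  inv := expEnd (-(LieAlgebra.ad ℂ 𝔤 x))
  val_inv := expEnd_mul_neg _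
  inv_val := by simpa using expEnd_mul_neg (-(LieAlgebra.ad ℂ 𝔤 x))

end Exponential

/-! ### Root data -/

variable {𝔤 : Type*} [LieRing 𝔤] [LieAlgebra ℂ 𝔤] [FiniteDimensional ℂ 𝔤]
  [LieAlgebra.IsSimple ℂ 𝔤] (H : LieSubalgebra ℂ 𝔤) [H.IsCartanSubalgebra]

variable {H} in
/-- The root `-α`. -/
def negRoot (α : H.root) : H.root :=
  ⟨-α.1, by
    have h := α.2
    simp only [LieSubalgebra.root, Finset.mem_filter, Finset.mem_univ, true_and] at h ⊢
    simpa using h⟩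

/-- A Weyl basis of `𝔤` relative to the Cartan subalgebra `H`: root vectors `X_α` with
`(X_α, X_{-α}) = 1` for the Cartan-Killing form, and `[X_α, X_β] = m_{α,β} X_{α+β}` with
`m_{α,β}` real, `m_{-α,-β} = -m_{α,β}`, and `m_{α,β} = 0` if `α + β` is not a root. -/
structure WeylBasis where
  /-- The root vectors. -/
  X : H.root → 𝔤
  mem_rootSpace : ∀ α : H.root, X α ∈ LieAlgebra.rootSpace H (α.1 : H → ℂ)
  killing_eq_one : ∀ α : H.root, killingForm ℂ 𝔤 (X α) (X (negRoot α)) = 1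
  /-- The structure constants. -/
  m : H.root → H.root → ℝ
  lie_eq : ∀ α β δ : H.root, (δ.1 : H → ℂ) = (α.1 : H → ℂ) + (β.1 : H → ℂ) →
    ⁅X α, X β⁆ = (m α β : ℂ) • X δ
  m_neg : ∀ α β : H.root, m (negRoot α) (negRoot β) = -m α β
  m_eq_zero : ∀ α β : H.root,
    (∀ δ : H.root, (δ.1 : H → ℂ) ≠ (α.1 : H → ℂ) + (β.1 : H → ℂ)) → m α β = 0

/-- The choices that determine a generalized flag manifold of the complex simple Lie algebra `𝔤`
with Cartan subalgebra `H`: a simple system of roots `Σ` (equivalently a choice of positive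
roots), a subset `Θ ⊆ Σ`, and a Weyl basis. -/
structure FlagDatum where
  /-- The simple system. -/
  base : (LieAlgebra.IsKilling.rootSystem H).Base
  /-- The set of simple roots defining the flag manifold. -/
  Θ : Finset H.root
  Θ_subset : Θ ⊆ base.support
  /-- The fixed Weyl basis. -/
  weyl : WeylBasis H

namespace FlagDatum

variable {H} (D : FlagDatum H)

/-- The set `⟨Θ⟩` of the roots spanned by `Θ`. -/
def thetaRoots : Set H.root :=
  {α | (LieAlgebra.IsKilling.rootSystem H).root α ∈
    Submodule.span ℤ ((LieAlgebra.IsKilling.rootSystem H).root '' (D.Θ : Set H.root))}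

open Classical in
/-- The set `Π⁺ \ ⟨Θ⟩`. -/
def mRoots : Finset H.root :=
  Finset.univ.filter fun α => D.base.IsPos α ∧ α ∉ D.thetaRoots

/-- `A_α = X_α - X_{-α}`. -/
def A (α : H.root) : 𝔤 := D.weyl.X α - D.weyl.X (negRoot α)

/-- `S_α = i (X_α + X_{-α})`. -/
def S (α : H.root) : 𝔤 := Complex.I • (D.weyl.X α + D.weyl.X (negRoot α))

/-- `H_α ∈ 𝔥`, the vector with `α(·) = (H_α, ·)`. -/
def coH (_D : FlagDatum H) (α : H.root) : 𝔤 :=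
  ((LieAlgebra.IsKilling.cartanEquivDual H).symm
    ((LieAlgebra.IsKilling.rootSystem H).root α) : H)

/-- The compact real form `𝔲 = span_ℝ {i H_α, A_α, S_α}`. -/
def u : Submodule ℝ 𝔤 :=
  Submodule.span ℝ (range (fun α : H.root => Complex.I • D.coH α) ∪ range D.A ∪ range D.S)

/-- `𝔲_α = span_ℝ {A_α, S_α}`. -/
def uRoot (α : H.root) : Submodule ℝ 𝔤 := Submodule.span ℝ {D.A α, D.S α}

/-- `𝔪_σ = ∑_{α ∈ σ} 𝔲_α`. -/
def mSum (σ : Finset H.root) : Submodule ℝ 𝔤 := ⨆ α ∈ σ, D.uRoot α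

/-- `𝔪_Θ = ∑_{α ∈ Π⁺ \ ⟨Θ⟩} 𝔲_α`, identified with the tangent space of the flag manifold at the
origin. -/
def m : Submodule ℝ 𝔤 := D.mSum D.mRoots

/-- The projection of `𝔤` onto `𝔤_α ⊕ 𝔤_{-α}` along the other root spaces and `𝔥`
(on `𝔲`: the orthogonal projection onto `𝔲_α`). It is written with `(X_α, X_{-α}) = 1` and the
fact that `X_{±α}` is orthogonal to `𝔥` and to all root spaces but `𝔤_{∓α}`. -/
def proj (α : H.root) : 𝔤 →ₗ[ℂ] 𝔤 :=
  ((killingForm ℂ 𝔤) (D.weyl.X (negRoot α))).smulRight (D.weyl.X α) +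
    ((killingForm ℂ 𝔤) (D.weyl.X α)).smulRight (D.weyl.X (negRoot α))

/-- The projection onto `∑_{α ∈ σ} (𝔤_α ⊕ 𝔤_{-α})` (on `𝔲`: the orthogonal projection onto
`𝔪_σ`). -/
def projSum (σ : Finset H.root) : 𝔤 →ₗ[ℂ] 𝔤 := ∑ α ∈ σ, D.proj α

/-- `Y ↦ Y_𝔪`, the projection of `𝔲 = 𝔨_Θ ⊕ 𝔪_Θ` onto `𝔪_Θ`. -/
def projM : 𝔤 →ₗ[ℂ] 𝔤 := D.projSum D.mRoots

/-! ### The flag manifold -/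

/-- The standard parabolic subalgebra
`𝔭_Θ = 𝔥 ⊕ ∑_{α ∈ ⟨Θ⟩⁻} 𝔤_α ⊕ ∑_{α ∈ Π⁺} 𝔤_α`. -/
def parabolic : Submodule ℂ 𝔤 :=
  H.toSubmodule ⊔
    (⨆ α : {α : H.root // α ∈ D.thetaRoots ∧ ¬ D.base.IsPos α},
      (LieAlgebra.rootSpace H (α.1.1 : H → ℂ)).toSubmodule) ⊔
    (⨆ α : {α : H.root // D.base.IsPos α},
      (LieAlgebra.rootSpace H (α.1.1 : H → ℂ)).toSubmodule)

/-- The compact group `U = exp 𝔲` in the adjoint group of `𝔤`. (The flag manifold, with the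
action on it, is the same for every connected Lie group with Lie algebra `𝔤`, since the center
of the group lies in the normalizer of `𝔭_Θ`.) -/
def U : Subgroup (Module.End ℂ 𝔤)ˣ := Subgroup.closure (expAd '' (D.u : Set 𝔤))

/-- The isotropy group `K_Θ = P_Θ ∩ U`, where `P_Θ` is the normalizer of `𝔭_Θ`:
the `k ∈ U` with `Ad(k) 𝔭_Θ = 𝔭_Θ`. -/
def K : Subgroup D.U where
  carrier := {k | D.parabolic.map (k.1.1 : 𝔤 →ₗ[ℂ] 𝔤) = D.parabolic}
  one_mem' := Submodule.map_id _
  mul_mem' {a b} ha hb := by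
    have h := Submodule.map_comp (b.1.1 : 𝔤 →ₗ[ℂ] 𝔤) (a.1.1 : 𝔤 →ₗ[ℂ] 𝔤) D.parabolic
    simp only [mem_ofPred_eq] at ha hb ⊢
    rw [hb, ha] at h
    exact h
  inv_mem' {a} ha := by
    have h := Submodule.map_comp (a.1.1 : 𝔤 →ₗ[ℂ] 𝔤) (a⁻¹.1.1 : 𝔤 →ₗ[ℂ] 𝔤) D.parabolic
    simp only [mem_ofPred_eq] at ha ⊢
    rw [ha] at h
    have hi : (a⁻¹.1.1 : 𝔤 →ₗ[ℂ] 𝔤) ∘ₗ (a.1.1 : 𝔤 →ₗ[ℂ] 𝔤) = LinearMap.id := a.1.inv_mul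
    rw [← h, hi, Submodule.map_id]

/-- The generalized flag manifold `𝔽_Θ = U / K_Θ`. -/
def Flag : Type _ := D.U ⧸ D.K

/-- The action of `U` on `𝔽_Θ = U / K_Θ`, `φ_g (h K_Θ) = g h K_Θ`. -/
instance : MulAction D.U D.Flag := MulAction.quotient D.U D.K

/-- The origin `o = e K_Θ`. -/
def origin : D.Flag := ((1 : D.U) : D.U ⧸ D.K)

/-- The exponential map `𝔲 → U`. -/
def exp (Y : D.u) : D.U :=
  ⟨expAd (Y : 𝔤), Subgroup.subset_closure (mem_image_of_mem _ Y.2)⟩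

/-- The adjoint action of `U` on `𝔤`. -/
def Ad (g : D.U) : 𝔤 →ₗ[ℂ] 𝔤 := g.1.1

/-! ### Isotropy components and invariant metrics -/

/-- `W ⊆ 𝔲` is invariant under the isotropy representation `Ad(K_Θ)`. -/
def IsotropyInvariant (W : Submodule ℝ 𝔤) : Prop :=
  ∀ k ∈ D.K, ∀ v ∈ W, D.Ad k v ∈ W

open Classical in
/-- `Π(Θ)`: the sets `σ ⊆ Π⁺ \ ⟨Θ⟩` for which `𝔪_σ` is an irreducible component of the isotropy
representation of `K_Θ` on `𝔪_Θ`. -/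
def components : Finset (Finset H.root) :=
  D.mRoots.powerset.filter fun σ =>
    D.mSum σ ≠ ⊥ ∧ D.IsotropyInvariant (D.mSum σ) ∧
      ∀ W : Submodule ℝ 𝔤, W ≤ D.mSum σ → D.IsotropyInvariant W → W = ⊥ ∨ W = D.mSum σ

/-- An invariant metric `Λ = (λ_σ)_{σ ∈ Π(Θ)}` on the flag manifold: a positive number for each
irreducible component. -/
structure InvariantMetric where
  /-- The numbers `λ_σ`. -/
  coeff : D.components → ℝ
  pos : ∀ σ, 0 < coeff σ

variable {D} in
/-- The scalar product `B_Λ = -∑_σ λ_σ (·, ·)|_{𝔪_σ}` on `𝔪_Θ`. (The Cartan-Killing form of `𝔤`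
is real on `𝔲`.) -/
def InvariantMetric.B (Λ : D.InvariantMetric) (v w : 𝔤) : ℝ :=
  -∑ σ : D.components, Λ.coeff σ *
    (killingForm ℂ 𝔤 (D.projSum σ.1 v) (D.projSum σ.1 w)).re

/-! ### Curves, energy, geodesics -/

/-- The curve `c` in `U/K_Θ` satisfies `c(t) = g · o` and is differentiable at `t` with velocity
`c'(t) = (dφ_g)_o (v)`, where `φ_g` is the action of `g` and `v ∈ 𝔪_Θ ≃ T_o`: near `t` the curve
lifts to a curve `h` in `U` with `h(t) = g` and `h'(t) = g · Y`, `Y ∈ 𝔲`, and `v = Y_𝔪`. -/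
def HasVelocity (c : ℝ → D.Flag) (t : ℝ) (g : D.U) (v : 𝔤) : Prop :=
  ∃ h : ℝ → D.U, (∀ᶠ r in 𝓝 t, c r = h r • D.origin) ∧ h t = g ∧
    ∃ Y ∈ D.u, (∀ y : 𝔤, HasCurveDerivAt (fun r => D.Ad (h r) y) (D.Ad g ⁅Y, y⁆) t) ∧
      v = D.projM Y

variable {D} in
open Classical in
/-- `|c'(t)|²` for the invariant metric `Λ`, which is `B_Λ(v, v)` if `c'(t) = (dφ_g)_o (v)`
(the value `0` if `c` is not differentiable at `t` is never used). -/
def InvariantMetric.speedSq (Λ : D.InvariantMetric) (c : ℝ → D.Flag) (t : ℝ) : ℝ :=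
  if h : ∃ p : D.U × 𝔤, D.HasVelocity c t p.1 p.2 then Λ.B h.choose.2 h.choose.2 else 0

variable {D} in
/-- The energy `∫_0^a |c'(t)|² dt` of the curve `c : [0, a] → U/K_Θ`. -/
def InvariantMetric.energy (Λ : D.InvariantMetric) (a : ℝ) (c : ℝ → D.Flag) : ℝ :=
  ∫ t in (0 : ℝ)..a, Λ.speedSq c t

/-- A map from a normed space to `U` is smooth (as a map into `End 𝔤`). -/
def SmoothToU {E : Type*} [NormedAddCommGroup E] [NormedSpace ℝ E] (F : E → D.U) : Prop :=
  ∀ y : 𝔤, IsCnOn ⊤ (fun e => D.Ad (F e) y) univ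

variable {D} in
/-- `c : [0, a] → U/K_Θ` is a geodesic for `Λ`: a smooth curve that is a critical point of the
energy with respect to all smooth variations with fixed end points. (A smooth curve in `U/K_Θ`,
or a smooth variation of it, is the projection of a smooth map into `U`.) -/
def InvariantMetric.IsGeodesic (Λ : D.InvariantMetric) (a : ℝ) (c : ℝ → D.Flag) : Prop :=
  (∃ h : ℝ → D.U, D.SmoothToU h ∧ ∀ t ∈ Icc 0 a, c t = h t • D.origin) ∧
    ∀ F : ℝ × ℝ → D.U, D.SmoothToU F →
      (∀ t ∈ Icc 0 a, F (0, t) • D.origin = c t) →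
      (∀ s, F (s, 0) • D.origin = c 0) →
      (∀ s, F (s, a) • D.origin = c a) →
      HasDerivAt (fun s => Λ.energy a (fun t => F (s, t) • D.origin)) 0 0

/-- The homogeneous curve `γ(t) = exp(tX) · o`. -/
def homCurve (X : D.u) (t : ℝ) : D.Flag := D.exp (t • X) • D.origin

/-- The variation `f(s, t) = exp(s q(t)) · γ(t)` of the homogeneous curve `γ(t) = exp(tX) · o`. -/
def variationOf (X : D.u) (q : ℝ → D.u) (s t : ℝ) : D.Flag :=
  D.exp (s • q t) • D.homCurve X t

variable {D} in
/-- The energy `E(s)` of the variation `f(s, t) = exp(s q(t)) · γ(t)`, `0 ≤ t ≤ a`. -/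
def InvariantMetric.variationEnergy (Λ : D.InvariantMetric) (a : ℝ) (X : D.u) (q : ℝ → D.u)
    (s : ℝ) : ℝ :=
  Λ.energy a (D.variationOf X q s)

variable {D} in
/-- The index form `I_Λ(q) = E''(0)`, the second variation of the energy of
`γ(t) = exp(tX) · o`, `0 ≤ t ≤ a`. -/
def InvariantMetric.indexForm (Λ : D.InvariantMetric) (a : ℝ) (X : D.u) (q : ℝ → D.u) : ℝ :=
  iteratedDeriv 2 (Λ.variationEnergy a X q) 0

/-! ### Perturbations -/

/-- The curve `γ(t) = exp(tX) · o`, `0 ≤ t ≤ a`, is subordinated to `𝒫`: writing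
`γ'(t) = ∑_α (dφ_{exp tX})_o (v_α(t))` with `v_α(t) ∈ 𝔲_α`, the components
`γ_α(t) = (dφ_{exp tX})_o (v_α(t))` vanish for all `α ∈ σ ∈ Π(Θ) \ 𝒫`. -/
def IsSubordinated (P : Set D.components) (a : ℝ) (X : D.u) : Prop :=
  ∀ t ∈ Icc 0 a, ∀ v : 𝔤, D.HasVelocity (D.homCurve X) t (D.exp (t • X)) v →
    ∀ σ : D.components, σ ∉ P → ∀ α ∈ σ.1, D.proj α v = 0

variable {D} in
/-- `Λ^#` is the `𝒫`-perturbation of `Λ` with parameters `ξ_σ`, `σ ∉ 𝒫`. -/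
def IsPerturbation (P : Set D.components) (Λ Λ' : D.InvariantMetric) (ξ : D.components → ℝ) :
    Prop :=
  (∀ σ ∈ P, Λ'.coeff σ = Λ.coeff σ) ∧ ∀ σ ∉ P, Λ'.coeff σ = Λ.coeff σ + ξ σ

/-- `f_α(t), g_α(t)` are the coordinates of `(Ad(exp(-tX)) p(t))_𝔪` in the basis
`A_α, S_α` (`α ∈ Π⁺ \ ⟨Θ⟩`), for `0 ≤ t ≤ a`. -/
def AreCoordinates (a : ℝ) (X : D.u) (p : ℝ → D.u) (f g : D.mRoots → ℝ → ℝ) : Prop :=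
  ∀ t ∈ Icc 0 a, D.projM (D.Ad (D.exp (-(t • X))) (p t)) =
    ∑ α : D.mRoots, (f α t • D.A α + g α t • D.S α)

/-- A set `σ ∈ Π(Θ)` consists of roots in `Π⁺ \ ⟨Θ⟩`. -/
theorem mem_mRoots (σ : D.components) (α : σ.1) : α.1 ∈ D.mRoots := by
  classical
  have h := σ.2
  unfold components at h
  rw [Finset.mem_filter, Finset.mem_powerset] at h
  exact h.1 α.2

end FlagDatum

end

end FlagPerturbation

/-! The variation lifts to the curve `exp(s q(t)) exp(tX)` in `U`. Duhamel's formula for the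
derivative of the exponential gives its left logarithmic derivative as `X + s W(s,t)`, where
`W(s,t)` is `e^{-t ad X}` applied to the mean over `τ` in `[0,1]` of `e^{-τ s ad q} q'`. An
invariant metric is a weighted sum of the squared moduli of the root components, so the contribution
of `σ` to the squared speed is `λ_σ ∑ 2 |x_α + s w_α(s,t)|²`, with `x_α = (X_α, X)` and `w_α = (X_α,
W)`.

Subordination says `x_α = 0` whenever `α ∈ σ ∉ P`. For such `σ` the contribution is exactly `s² λ_σ
∑ 2 |w_α|²`, hence the two energies differ by `s² R(s)`, where `R` is the integral of `∑ ξ_σ ∑ 2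
|w_α|²`. Since `R` is of class `C²`, the second derivative of the difference at `0` is `2 R(0)`. At
`s = 0` the mean collapses, `W(0,t) = Ad(exp(-tX)) q'(t)`, and `|w_α(0,t)|² = f_α² + g_α²`. The
factor 4 is this 2 times the 2 coming from the root pair `±α`.

Two points need care. The speed is defined through an arbitrary lift, so it must be shown
independent of the lift: this is `killingForm_X_eq_of_lifts` together with the isotropy invariance
`B_projM_Ad`. Differentiation in `s` under the integral in `t` is handled by `IsC2Family`. The exact
formulas are `hasVelocity_variationOf` and `variationSpeedSq_perturbation`. -/

namespace FlagPerturbation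

noncomputable section

/-! ### Derivative of the exponential in a Banach algebra -/

section BanachAlgebra

open NormedSpace

variable {𝔸 : Type*} [NormedRing 𝔸] [NormedAlgebra ℝ 𝔸] [CompleteSpace 𝔸]

theorem continuous_exp_real : Continuous (exp : 𝔸 → 𝔸) :=
  let _ := NormedAlgebra.restrictScalars ℚ ℝ 𝔸
  exp_continuous

theorem exp_neg_mul_exp (A : 𝔸) : exp (-A) * exp A = 1 := by
  let _ := NormedAlgebra.restrictScalars ℚ ℝ 𝔸
  rw [← exp_add_of_commute (Commute.refl A).neg_left, neg_add_cancel, exp_zero]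

theorem exp_mul_exp_neg (A : 𝔸) : exp A * exp (-A) = 1 := by
  let _ := NormedAlgebra.restrictScalars ℚ ℝ 𝔸
  rw [← exp_add_of_commute (Commute.refl A).neg_right, add_neg_cancel, exp_zero]

theorem hasDerivAt_exp_smul_mul_exp_smul (A B C : 𝔸) (r : ℝ) :
    HasDerivAt (fun r : ℝ => exp (-(r • A)) * C * exp (r • B))
      (exp (-(r • A)) * (C * B - A * C) * exp (r • B)) r := by
  have h1 : HasDerivAt (fun r : ℝ => exp (-(r • A))) (exp (-(r • A)) * -A) r := by
    simpa using hasDerivAt_exp_smul_const (𝕂 := ℝ) (-A) r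
  have h2 := hasDerivAt_exp_smul_const' (𝕂 := ℝ) B r
  refine ((h1.mul_const C).mul h2).congr_deriv ?_
  noncomm_ring

/-- Duhamel's formula for a difference of exponentials. -/
theorem exp_sub_exp_eq_integral (A B : 𝔸) :
    exp B - exp A = exp A * ∫ τ in (0 : ℝ)..1, exp (-(τ • A)) * (B - A) * exp (τ • B) := by
  have h := intervalIntegral.integral_eq_sub_of_hasDerivAt
    (fun τ _ => hasDerivAt_exp_smul_mul_exp_smul A B 1 τ) (a := (0 : ℝ)) (b := 1)
    (Continuous.intervalIntegrable (by
      have := continuous_exp_real (𝔸 := 𝔸)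
      fun_prop) _ _)
  simp only [one_mul, mul_one, one_smul, zero_smul, neg_zero, exp_zero] at h
  rw [h, mul_sub, ← mul_assoc, exp_mul_exp_neg, one_mul, mul_one]

/-- The derivative of the exponential along a differentiable curve in a Banach algebra. -/
theorem hasDerivAt_exp_comp {Q : ℝ → 𝔸} {Q' : 𝔸} {t : ℝ} (hQ : HasDerivAt Q Q' t) :
    HasDerivAt (fun r => exp (Q r))
      (exp (Q t) * ∫ τ in (0 : ℝ)..1, exp (-(τ • Q t)) * Q' * exp (τ • Q t)) t := by
  have hexp := continuous_exp_real (𝔸 := 𝔸)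
  -- By Duhamel's formula the difference quotient of `exp ∘ Q` is this integral at `(Q r, slope)`,
  -- multiplied by `exp (Q t)`. Joint continuity lets the limit pass inside, with only
  -- differentiability of `Q` at `t`.
  have hc : Continuous fun p : 𝔸 × 𝔸 =>
      ∫ τ in (0 : ℝ)..1, exp (-(τ • Q t)) * p.2 * exp (τ • p.1) := by
    apply intervalIntegral.continuous_parametric_intervalIntegral_of_continuous'
    unfold Function.uncurry
    fun_prop
  rw [hasDerivAt_iff_tendsto_slope] at hQ ⊢
  have hQc : Tendsto Q (𝓝[≠] t) (𝓝 (Q t)) :=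
    ((hasDerivAt_iff_tendsto_slope.2 hQ).continuousAt.tendsto).mono_left nhdsWithin_le_nhds
  have h := (((hc.tendsto (Q t, Q')).comp (hQc.prodMk_nhds hQ))).const_mul (exp (Q t))
  refine h.congr fun r => ?_
  simp only [Function.comp, slope_def_module]
  rw [exp_sub_exp_eq_integral, ← mul_smul_comm, ← intervalIntegral.integral_smul]
  congr 1
  refine intervalIntegral.integral_congr fun τ _ => ?_
  simp only [mul_smul_comm, smul_mul_assoc]

end BanachAlgebra

/-! ### Twice differentiable dependence on a parameter -/

section ParametricIntegral

variable {T S W : Type*} [TopologicalSpace T] [TopologicalSpace S] [NormedAddCommGroup W]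
  [NormedSpace ℝ W]

/-- A family of `C²` functions of a real variable, which depends continuously on a parameter
together with the first two derivatives. -/
def IsC2Family (F : ℝ → T → W) : Prop :=
  ∃ F₁ F₂ : ℝ → T → W, (∀ s t, HasDerivAt (fun s => F s t) (F₁ s t) s) ∧
    (∀ s t, HasDerivAt (fun s => F₁ s t) (F₂ s t) s) ∧ Continuous (Function.uncurry F) ∧
    Continuous (Function.uncurry F₁) ∧ Continuous (Function.uncurry F₂)

theorem IsC2Family.comp {F : ℝ → T → W} (hF : IsC2Family F) {g : S → T} (hg : Continuous g) :
    IsC2Family fun s x => F s (g x) := by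
  obtain ⟨F₁, F₂, h₁, h₂, c₀, c₁, c₂⟩ := hF
  have hg' : Continuous fun p : ℝ × S => (p.1, g p.2) := by fun_prop
  exact ⟨fun s x => F₁ s (g x), fun s x => F₂ s (g x), fun s x => h₁ s (g x),
    fun s x => h₂ s (g x), c₀.comp hg', c₁.comp hg', c₂.comp hg'⟩

theorem IsC2Family.continuous {F : ℝ → T → W} (hF : IsC2Family F) :
    Continuous (Function.uncurry F) := by
  obtain ⟨_, _, _, _, c₀, _, _⟩ := hF
  exact c₀

theorem IsC2Family.mul {R : Type*} [NormedRing R] [NormedAlgebra ℝ R] {F G : ℝ → T → R}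
    (hF : IsC2Family F) (hG : IsC2Family G) : IsC2Family fun s t => F s t * G s t := by
  obtain ⟨F₁, F₂, h₁, h₂, c₀, c₁, c₂⟩ := hF
  obtain ⟨G₁, G₂, k₁, k₂, d₀, d₁, d₂⟩ := hG
  refine ⟨fun s t => F₁ s t * G s t + F s t * G₁ s t,
    fun s t => (F₂ s t * G s t + F₁ s t * G₁ s t) + (F₁ s t * G₁ s t + F s t * G₂ s t),
    fun s t => (h₁ s t).mul (k₁ s t),
    fun s t => ((h₂ s t).mul (k₁ s t)).add ((h₁ s t).mul (k₂ s t)) , ?_, ?_, ?_⟩ <;>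
  · unfold Function.uncurry at *
    fun_prop

theorem IsC2Family.clm_comp {V : Type*} [NormedAddCommGroup V] [NormedSpace ℝ V]
    {F : ℝ → T → W} (hF : IsC2Family F) (L : W →L[ℝ] V) : IsC2Family fun s t => L (F s t) := by
  obtain ⟨F₁, F₂, h₁, h₂, c₀, c₁, c₂⟩ := hF
  exact ⟨fun s x => L (F₁ s x), fun s x => L (F₂ s x),
    fun s x => L.hasFDerivAt.comp_hasDerivAt s (h₁ s x),
    fun s x => L.hasFDerivAt.comp_hasDerivAt s (h₂ s x), L.continuous.comp c₀,
    L.continuous.comp c₁, L.continuous.comp c₂⟩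

/-- The continuous `F₁` is bounded on a compact box around `s`, and the bound serves as the
dominating function. -/
theorem hasDerivAt_intervalIntegral_of_continuous {F F₁ : ℝ → ℝ → W}
    (h : ∀ s t, HasDerivAt (fun s => F s t) (F₁ s t) s) (hF : Continuous (Function.uncurry F))
    (hF₁ : Continuous (Function.uncurry F₁)) (a b s : ℝ) :
    HasDerivAt (fun s => ∫ t in a..b, F s t) (∫ t in a..b, F₁ s t) s := by
  obtain ⟨C, hC⟩ := ((isCompact_closedBall s 1).prod (isCompact_uIcc (a := a) (b := b)))
    |>.exists_bound_of_continuousOn hF₁.continuousOn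
  refine (intervalIntegral.hasDerivAt_integral_of_dominated_loc_of_deriv_le (F' := F₁)
    (bound := fun _ => C) (Metric.closedBall_mem_nhds s one_pos)
    (Eventually.of_forall fun x => (hF.uncurry_left x).aestronglyMeasurable)
    ((hF.uncurry_left s).intervalIntegrable _ _) (hF₁.uncurry_left s).aestronglyMeasurable
    (Eventually.of_forall fun t ht x hx => hC (x, t) ⟨hx, uIoc_subset_uIcc ht⟩)
    (by simp) (Eventually.of_forall fun t _ x _ => h x t)).2

theorem IsC2Family.integral [FirstCountableTopology T] {F : ℝ → T × ℝ → W} (hF : IsC2Family F)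
    (a b : ℝ) : IsC2Family fun s t => ∫ τ in a..b, F s (t, τ) := by
  obtain ⟨F₁, F₂, h₁, h₂, c₀, c₁, c₂⟩ := hF
  have hc : ∀ G : ℝ → T × ℝ → W, Continuous (Function.uncurry G) →
      Continuous (Function.uncurry fun s t => ∫ τ in a..b, G s (t, τ)) := fun G hG =>
    intervalIntegral.continuous_parametric_intervalIntegral_of_continuous'
      (f := fun (p : ℝ × T) τ => G p.1 (p.2, τ)) (hG.comp (by fun_prop :
        Continuous fun x : (ℝ × T) × ℝ => (x.1.1, (x.1.2, x.2)))) a b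
  have hs : ∀ G : ℝ → T × ℝ → W, Continuous (Function.uncurry G) → ∀ t,
      Continuous (Function.uncurry fun s τ => G s (t, τ)) := fun G hG t =>
    hG.comp (by fun_prop : Continuous fun x : ℝ × ℝ => (x.1, (t, x.2)))
  exact ⟨fun s t => ∫ τ in a..b, F₁ s (t, τ), fun s t => ∫ τ in a..b, F₂ s (t, τ),
    fun s t => hasDerivAt_intervalIntegral_of_continuous (fun s τ => h₁ s (t, τ)) (hs _ c₀ t)
      (hs _ c₁ t) a b s,
    fun s t => hasDerivAt_intervalIntegral_of_continuous (fun s τ => h₂ s (t, τ)) (hs _ c₁ t)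
      (hs _ c₂ t) a b s, hc _ c₀, hc _ c₁, hc _ c₂⟩

theorem IsC2Family.contDiff {F : ℝ → T → W} (hF : IsC2Family F) (t : T) :
    ContDiff ℝ 2 fun s => F s t := by
  obtain ⟨F₁, F₂, h₁, h₂, c₀, c₁, c₂⟩ := hF
  have e₁ : deriv (fun s => F s t) = fun s => F₁ s t := funext fun s => (h₁ s t).deriv
  have e₂ : deriv (fun s => F₁ s t) = fun s => F₂ s t := funext fun s => (h₂ s t).deriv
  rw [show (2 : WithTop ℕ∞) = 1 + 1 by norm_num, contDiff_succ_iff_deriv]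
  refine ⟨fun s => (h₁ s t).differentiableAt, by simp, ?_⟩
  rw [e₁, contDiff_one_iff_deriv, e₂]
  exact ⟨fun s => (h₂ s t).differentiableAt,
    c₂.comp (by fun_prop : Continuous fun s : ℝ => (s, t))⟩

theorem isC2Family_exp_smul {𝔸 : Type*} [NormedRing 𝔸] [NormedAlgebra ℝ 𝔸] [CompleteSpace 𝔸]
    {A : T → 𝔸} (hA : Continuous A) : IsC2Family fun s t => NormedSpace.exp (s • A t) := by
  have hexp := continuous_exp_real (𝔸 := 𝔸)
  refine ⟨fun s t => NormedSpace.exp (s • A t) * A t,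
    fun s t => NormedSpace.exp (s • A t) * A t * A t,
    fun s t => hasDerivAt_exp_smul_const (A t) s,
    fun s t => (hasDerivAt_exp_smul_const (A t) s).mul_const (A t), ?_, ?_, ?_⟩ <;>
  · unfold Function.uncurry
    fun_prop

theorem isC2Family_const {c : T → W} (hc : Continuous c) : IsC2Family fun _ t => c t :=
  ⟨fun _ _ => 0, fun _ _ => 0, fun _ _ => hasDerivAt_const _ _, fun _ _ => hasDerivAt_const _ _,
    hc.comp continuous_snd, continuous_const, continuous_const⟩

theorem IsC2Family.add {F G : ℝ → T → W} (hF : IsC2Family F) (hG : IsC2Family G) :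
    IsC2Family fun s t => F s t + G s t := by
  obtain ⟨F₁, F₂, h₁, h₂, c₀, c₁, c₂⟩ := hF
  obtain ⟨G₁, G₂, k₁, k₂, d₀, d₁, d₂⟩ := hG
  exact ⟨fun s t => F₁ s t + G₁ s t, fun s t => F₂ s t + G₂ s t,
    fun s t => (h₁ s t).add (k₁ s t), fun s t => (h₂ s t).add (k₂ s t), c₀.add d₀, c₁.add d₁,
    c₂.add d₂⟩

theorem IsC2Family.sum {ι : Type*} {F : ι → ℝ → T → W} (I : Finset ι)
    (hF : ∀ i ∈ I, IsC2Family (F i)) : IsC2Family fun s t => ∑ i ∈ I, F i s t := by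
  classical
  induction I using Finset.induction_on with
  | empty => simpa using isC2Family_const (T := T) (W := W) continuous_const
  | insert i I hi ih =>
    simp only [Finset.sum_insert hi]
    exact (hF i (by simp)).add (ih fun j hj => hF j (by simp [hj]))

theorem isC2Family_ofReal : IsC2Family fun (s : ℝ) (_ : T) => (s : ℂ) :=
  ⟨fun _ _ => 1, fun _ _ => 0, fun _ _ => Complex.ofRealCLM.hasDerivAt,
    fun _ _ => hasDerivAt_const _ _, Complex.continuous_ofReal.comp continuous_fst,
    continuous_const, continuous_const⟩

theorem IsC2Family.normSq {F : ℝ → T → ℂ} (hF : IsC2Family F) :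
    IsC2Family fun s t => Complex.normSq (F s t) := by
  have h := ((hF.clm_comp Complex.conjCLE.toContinuousLinearMap).mul hF).clm_comp Complex.reCLM
  refine (funext₂ fun s t => ?_ : _ = fun s t => Complex.normSq (F s t)) ▸ h
  simp [Complex.normSq_apply]

theorem IsC2Family.const_mul {F : ℝ → T → ℝ} (hF : IsC2Family F) (c : ℝ) :
    IsC2Family fun s t => c * F s t :=
  (isC2Family_const continuous_const).mul hF

theorem IsC2Family.contDiff_integral {F : ℝ → ℝ → W} (hF : IsC2Family F) (a b : ℝ) :
    ContDiff ℝ 2 fun s => ∫ t in a..b, F s t :=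
  ((hF.comp (continuous_snd (X := Unit) (Y := ℝ))).integral a b).contDiff ()

end ParametricIntegral

/-- At `0` only the term with both derivatives on `s ^ 2` survives. The difference of the two
energies has this form. -/
theorem iteratedDeriv_two_sq_mul {R : ℝ → ℝ} (hR : ContDiff ℝ 2 R) :
    iteratedDeriv 2 (fun s => s ^ 2 * R s) 0 = 2 * R 0 := by
  have hR1 : ContDiff ℝ 1 (deriv R) :=
    (contDiff_succ_iff_deriv.1 (by simpa [one_add_one_eq_two] using hR)).2.2
  have h0 : ∀ s, HasDerivAt R (deriv R s) s := fun s =>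
    (hR.differentiable (by norm_num) s).hasDerivAt
  have h1 := (hR1.differentiable (by norm_num) 0).hasDerivAt
  have e : deriv (fun s => s ^ 2 * R s) = fun s => 2 * s * R s + s ^ 2 * deriv R s := by
    funext s
    simpa [Pi.mul_def] using ((hasDerivAt_pow 2 s).mul (h0 s)).deriv
  rw [iteratedDeriv_succ, iteratedDeriv_one, e]
  have := (((hasDerivAt_id (0 : ℝ)).const_mul 2).mul (h0 0)).add ((hasDerivAt_pow 2 (0 : ℝ)).mul h1)
  simpa [Pi.mul_def, Pi.add_def] using this.deriv

/-! ### Curves described by linear functionals -/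

section Curves

variable {V E : Type*} [AddCommGroup V] [Module ℝ V] [NormedAddCommGroup E] [NormedSpace ℝ E]
  [FiniteDimensional ℝ E]

theorem HasCurveDerivWithinAt.linearMap {c : ℝ → V} {v : V} {s : Set ℝ} {t : ℝ}
    (h : HasCurveDerivWithinAt c v s t) (L : V →ₗ[ℝ] E) :
    HasDerivWithinAt (fun r => L (c r)) (L v) s t := by
  let e : E ≃L[ℝ] (Fin (Module.finrank ℝ E) → ℝ) :=
    (Module.finBasis ℝ E).equivFun.toContinuousLinearEquiv
  have h1 : HasDerivWithinAt (fun r => e (L (c r))) (e (L v)) s t := by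
    rw [hasDerivWithinAt_pi]
    exact fun i => h (((LinearMap.proj i).comp e.toLinearEquiv.toLinearMap).comp L)
  simpa [Function.comp_def] using
    (e.symm.toContinuousLinearMap.hasFDerivAt.comp_hasDerivWithinAt t h1)

theorem HasCurveDerivAt.linearMap {c : ℝ → V} {v : V} {t : ℝ}
    (h : HasCurveDerivAt c v t) (L : V →ₗ[ℝ] E) : HasDerivAt (fun r => L (c r)) (L v) t :=
  hasDerivWithinAt_univ.1 (HasCurveDerivWithinAt.linearMap h L)

theorem IsCnOn.linearMap {F : Type*} [NormedAddCommGroup F] [NormedSpace ℝ F] {n : ℕ∞}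
    {c : F → V} {s : Set F} (h : IsCnOn n c s) (L : V →ₗ[ℝ] E) :
    ContDiffOn ℝ n (fun r => L (c r)) s := by
  let e : E ≃L[ℝ] (Fin (Module.finrank ℝ E) → ℝ) :=
    (Module.finBasis ℝ E).equivFun.toContinuousLinearEquiv
  have h1 : ContDiffOn ℝ n (fun r => e (L (c r))) s := by
    rw [contDiffOn_pi]
    exact fun i => h (((LinearMap.proj i).comp e.toLinearEquiv.toLinearMap).comp L)
  simpa [Function.comp_def] using e.symm.contDiff.comp_contDiffOn h1

theorem hasCurveDerivAt_linearMap {c : ℝ → E} {v : E} {t : ℝ} (h : HasDerivAt c v t)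
    (L : E →ₗ[ℝ] V) : HasCurveDerivAt (fun r => L (c r)) (L v) t := fun φ =>
  ((LinearMap.toContinuousLinearMap (φ.comp L)).hasFDerivAt.comp_hasDerivAt t h).hasDerivWithinAt

theorem HasCurveDerivAt.bilinear {V : Type*} [AddCommGroup V] [Module ℂ V]
    [FiniteDimensional ℂ V] {c₁ c₂ : ℝ → V} {v₁ v₂ : V} {t : ℝ} (h₁ : HasCurveDerivAt c₁ v₁ t)
    (h₂ : HasCurveDerivAt c₂ v₂ t) (b : V →ₗ[ℂ] V →ₗ[ℂ] ℂ) :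
    HasDerivAt (fun r => b (c₁ r) (c₂ r)) (b v₁ (c₂ t) + b (c₁ t) v₂) t := by
  let B := Module.finBasis ℂ V
  have expand : ∀ x y, b x y = ∑ j, B.coord j y * b x (B j) := fun x y => by
    conv_lhs => rw [← B.sum_repr y]
    simp only [map_sum, map_smul, smul_eq_mul, Module.Basis.coord_apply]
  have h := HasDerivAt.fun_sum (u := Finset.univ) fun j _ =>
    (h₂.linearMap ((B.coord j).restrictScalars ℝ)).mul
      (h₁.linearMap ((b.flip (B j)).restrictScalars ℝ))
  simp only [LinearMap.coe_restrictScalars, LinearMap.flip_apply] at h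
  have e : (fun r => b (c₁ r) (c₂ r)) =
      fun r => ∑ j, B.coord j (c₂ r) * b (c₁ r) (B j) := funext fun r => expand _ _
  rw [e, expand v₁, expand (c₁ t) v₂, ← Finset.sum_add_distrib]
  refine h.congr_deriv (Finset.sum_congr rfl fun j _ => ?_)
  ring

end Curves

/-! ### The adjoint representation inside a Banach algebra -/

section Exponential

open NormedSpace LieAlgebra

variable {𝔤 : Type*} [LieRing 𝔤] [LieAlgebra ℂ 𝔤] [FiniteDimensional ℂ 𝔤]

variable (𝔤) in
/-- The algebra of endomorphisms of `𝔤`, as the carrier of a Banach algebra structure. -/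
def Mat : Type := Matrix (Fin (Module.finrank ℂ 𝔤)) (Fin (Module.finrank ℂ 𝔤)) ℂ

variable (𝔤) in
-- The norm is an auxiliary choice (the row-sum norm of matrices). Afterwards only the ring
-- isomorphism, its compatibility with real scalars and with exponentials are used.
theorem exists_banachAlgebra : ∃ (_ : NormedRing (Mat 𝔤)) (_ : NormedAlgebra ℝ (Mat 𝔤))
    (_ : FiniteDimensional ℝ (Mat 𝔤)) (e : Module.End ℂ 𝔤 ≃+* Mat 𝔤),
    (∀ (r : ℝ) (f : Module.End ℂ 𝔤), e ((r : ℂ) • f) = r • e f) ∧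
      ∀ f, e (expEnd f) = exp (e f) := by
  let e := LinearMap.toMatrixAlgEquiv (Module.finBasis ℂ 𝔤)
  refine ⟨Matrix.linftyOpNormedRing, Matrix.linftyOpNormedAlgebra, ?_, e.toRingEquiv,
    fun r f => ?_, fun f => ?_⟩
  · exact inferInstanceAs (FiniteDimensional ℝ
      (Matrix (Fin (Module.finrank ℂ 𝔤)) (Fin (Module.finrank ℂ 𝔤)) ℂ))
  · exact map_smul e (r : ℂ) f
  · exact e.apply_symm_apply _

instance : NormedRing (Mat 𝔤) := (exists_banachAlgebra 𝔤).choose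

instance : NormedAlgebra ℝ (Mat 𝔤) := (exists_banachAlgebra 𝔤).choose_spec.choose

instance : FiniteDimensional ℝ (Mat 𝔤) := (exists_banachAlgebra 𝔤).choose_spec.choose_spec.choose

instance : CompleteSpace (Mat 𝔤) := FiniteDimensional.complete ℝ (Mat 𝔤)

/-- The isomorphism of the algebra of endomorphisms with a Banach algebra. -/
def toMat : Module.End ℂ 𝔤 ≃+* Mat 𝔤 :=
  (exists_banachAlgebra 𝔤).choose_spec.choose_spec.choose_spec.choose

theorem toMat_smul (r : ℝ) (f : Module.End ℂ 𝔤) : toMat ((r : ℂ) • f) = r • toMat f :=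
  (exists_banachAlgebra 𝔤).choose_spec.choose_spec.choose_spec.choose_spec.1 r f

theorem toMat_expEnd (f : Module.End ℂ 𝔤) : toMat (expEnd f) = exp (toMat f) :=
  (exists_banachAlgebra 𝔤).choose_spec.choose_spec.choose_spec.choose_spec.2 f

/-- The image of `ad x` in the Banach algebra of endomorphisms. -/
def adMat : 𝔤 →ₗ[ℝ] Mat 𝔤 where
  toFun x := toMat (ad ℂ 𝔤 x)
  map_add' x y := by simp
  map_smul' r x := by
    rw [RingHom.id_apply, ← toMat_smul, ← map_smul, Complex.coe_smul]

theorem adMat_apply (x : 𝔤) : adMat x = toMat (ad ℂ 𝔤 x) := rfl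

/-- The action of the Banach algebra of endomorphisms on a vector of `𝔤`. -/
def matAct (y : 𝔤) : Mat 𝔤 →ₗ[ℝ] 𝔤 where
  toFun M := toMat.symm M y
  map_add' M N := by simp
  map_smul' r M := by
    obtain ⟨f, rfl⟩ := toMat.surjective M
    rw [← toMat_smul]
    simp

theorem matAct_apply (y : 𝔤) (M : Mat 𝔤) : matAct y M = toMat.symm M y := rfl

theorem matAct_mul (y : 𝔤) (M N : Mat 𝔤) : matAct y (M * N) = matAct (matAct y N) M := by
  simp [matAct_apply]

theorem matAct_adMat (x y : 𝔤) : matAct y (adMat x) = ⁅x, y⁆ := by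
  simp [matAct_apply, adMat_apply]

theorem matAct_one (y : 𝔤) : matAct y 1 = y := by simp [matAct_apply]

theorem matAct_ext {M N : Mat 𝔤} (h : ∀ y, matAct y M = matAct y N) : M = N :=
  toMat.symm.injective (LinearMap.ext h)

theorem expAd_apply (x y : 𝔤) : (expAd x).1 y = matAct y (exp (adMat x)) := by
  rw [adMat_apply, ← toMat_expEnd, matAct_apply, RingEquiv.symm_apply_apply]
  rfl

theorem adMat_lie (x y : 𝔤) : adMat ⁅x, y⁆ = adMat x * adMat y - adMat y * adMat x := by
  refine matAct_ext fun z => ?_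
  simp [map_sub, matAct_mul, matAct_adMat]

/-- `ad (e^{-ad x} y) = e^{-ad x} (ad y) e^{ad x}`. -/
theorem exp_neg_mul_adMat_mul_exp (x y : 𝔤) :
    exp (-adMat x) * adMat y * exp (adMat x) = adMat (matAct y (exp (-adMat x))) := by
  set A := adMat x with hA
  let L : Mat 𝔤 →L[ℝ] Mat 𝔤 := LinearMap.toContinuousLinearMap (adMat.comp (matAct y))
  have hL : ∀ M, L M = adMat (matAct y M) := fun _ => rfl
  -- The curve `e^{rA} ad(e^{-rA} y) e^{-rA}` is constant, because `ad` turns the action of `A` on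
  -- vectors into the commutator with `A`. The identity compares `r = 1` with `r = 0`.
  have hd : ∀ r : ℝ, HasDerivAt (fun r : ℝ => exp (r • A) * L (exp (-(r • A))) * exp (-(r • A)))
      0 r := by
    intro r
    have h1 := hasDerivAt_exp_smul_const (𝕂 := ℝ) A r
    have h2 := hasDerivAt_exp_smul_const' (𝕂 := ℝ) (-A) r
    simp only [smul_neg] at h2
    have h3 := L.hasFDerivAt.comp_hasDerivAt r h2
    refine ((h1.mul h3).mul h2).congr_deriv ?_
    have e : L (-A * exp (-(r • A))) =
        -(A * L (exp (-(r • A))) - L (exp (-(r • A))) * A) := by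
      rw [neg_mul, map_neg, hL, hL, matAct_mul, matAct_adMat, adMat_lie]
    simp only [Pi.mul_apply, Function.comp_apply]
    rw [e]
    noncomm_ring
  have hc := is_const_of_deriv_eq_zero (fun r => (hd r).differentiableAt) (fun r => (hd r).deriv)
    1 0
  simp only [one_smul, zero_smul, neg_zero, exp_zero, one_mul, mul_one, hL, matAct_one] at hc
  rw [← hc]
  simp only [← mul_assoc]
  rw [exp_neg_mul_exp, one_mul, mul_assoc, exp_neg_mul_exp, mul_one]

theorem expAd_lie (x y z : 𝔤) : (expAd x).1 ⁅y, z⁆ = ⁅(expAd x).1 y, (expAd x).1 z⁆ := by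
  have h := exp_neg_mul_adMat_mul_exp (-x) y
  rw [map_neg, neg_neg] at h
  simp only [expAd_apply]
  rw [← matAct_adMat, ← matAct_adMat, ← h, ← matAct_mul, ← matAct_mul, mul_assoc, mul_assoc,
    exp_neg_mul_exp, mul_one]

theorem coe_expAd_neg (x : 𝔤) : expAd (-x) = (expAd x)⁻¹ := by
  refine Units.ext ?_
  change expEnd (ad ℂ 𝔤 (-x)) = expEnd (-(ad ℂ 𝔤 x))
  rw [map_neg]

theorem killingForm_map_of_map_lie {𝔤 : Type*} [LieRing 𝔤] [LieAlgebra ℂ 𝔤]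
    (g : (Module.End ℂ 𝔤)ˣ)
    (hg : ∀ y z, g.1 ⁅y, z⁆ = ⁅g.1 y, g.1 z⁆) (y z : 𝔤) :
    killingForm ℂ 𝔤 (g.1 y) (g.1 z) = killingForm ℂ 𝔤 y z := by
  let e : 𝔤 ≃ₗ[ℂ] 𝔤 := LinearMap.GeneralLinearGroup.toLinearEquiv g
  have he : ∀ y, e y = g.1 y := fun _ => rfl
  let e' : 𝔤 ≃ₗ⁅ℂ⁆ 𝔤 := { e with map_lie' := fun {y z} => hg y z }
  exact killingForm_of_equiv_apply e' y z

section Invariant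

variable (S : Submodule ℝ 𝔤)

/-- The matrices which preserve a real subspace. -/
def matStabilizer : Submodule ℝ (Mat 𝔤) where
  carrier := {M | ∀ v ∈ S, matAct v M ∈ S}
  add_mem' hM hN v hv := by simpa using S.add_mem (hM v hv) (hN v hv)
  zero_mem' v _ := by simp
  smul_mem' r M hM v hv := by simpa using S.smul_mem r (hM v hv)

variable {S} {M : Mat 𝔤}

/-- The stabilizer contains the powers of `M` and is a closed subspace, so it contains the sum of
the exponential series. -/
theorem exp_mem_matStabilizer (hM : M ∈ matStabilizer S) : exp M ∈ matStabilizer S := by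
  have hpow : ∀ n : ℕ, M ^ n ∈ matStabilizer S := fun n => by
    induction n with
    | zero => intro v hv; simpa [matAct_one] using hv
    | succ n ih => intro v hv; rw [pow_succ, matAct_mul]; exact ih _ (hM v hv)
  have hc : IsClosed (matStabilizer S : Set (Mat 𝔤)) := Submodule.closed_of_finiteDimensional _
  refine hc.mem_of_tendsto (exp_series_hasSum_exp' (𝕂 := ℝ) M) (Eventually.of_forall fun s => ?_)
  exact Submodule.sum_mem _ fun i _ => Submodule.smul_mem _ _ (hpow i)

theorem integral_exp_mem_matStabilizer (hM : M ∈ matStabilizer S) :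
    ∫ τ in (0 : ℝ)..1, exp (-(τ • M)) ∈ matStabilizer S := by
  by_contra hn
  -- A functional vanishing on the stabilizer but not on the integral contradicts that it commutes
  -- with integration.
  obtain ⟨φ, hφ, hS⟩ := Submodule.exists_le_ker_of_notMem hn
  refine hφ ?_
  have hexp := continuous_exp_real (𝔸 := Mat 𝔤)
  have h := (LinearMap.toContinuousLinearMap φ).intervalIntegral_comp_comm
    (μ := MeasureTheory.volume)
    ((by fun_prop : Continuous fun τ : ℝ => exp (-(τ • M))).intervalIntegrable 0 1)
  simp only [LinearMap.coe_toContinuousLinearMap'] at h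
  rw [← h]
  refine intervalIntegral.integral_zero_ae (Eventually.of_forall fun τ _ => ?_)
  exact hS (exp_mem_matStabilizer (Submodule.neg_mem _ (Submodule.smul_mem _ _ hM)))

end Invariant

/-- The element `∫₀¹ e^{-τ s ad x} v dτ` of `𝔤`. -/
def meanExp (x v : 𝔤) : 𝔤 := matAct v (∫ τ in (0 : ℝ)..1, exp (-(τ • adMat x)))

theorem hasDerivAt_exp_adMat {q : ℝ → Mat 𝔤} {x v : 𝔤} {t : ℝ} (hx : q t = adMat x)
    (hq : HasDerivAt q (adMat v) t) :
    HasDerivAt (fun r => exp (q r)) (exp (q t) * adMat (meanExp x v)) t := by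
  refine (hasDerivAt_exp_comp hq).congr_deriv ?_
  congr 1
  let L : Mat 𝔤 →L[ℝ] Mat 𝔤 := LinearMap.toContinuousLinearMap (adMat.comp (matAct v))
  have hexp := continuous_exp_real (𝔸 := Mat 𝔤)
  have h := L.intervalIntegral_comp_comm (μ := MeasureTheory.volume)
    ((by fun_prop : Continuous fun τ : ℝ => exp (-(τ • adMat x))).intervalIntegrable 0 1)
  refine Eq.trans ?_ h
  refine intervalIntegral.integral_congr fun τ _ => ?_
  have := exp_neg_mul_adMat_mul_exp (τ • x) v
  rw [map_smul, ← hx] at this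
  refine this.trans ?_
  rw [hx]
  rfl

/-- The velocity of the curve `r ↦ e^{ad c(r)} e^{r ad x}`. -/
theorem hasDerivAt_exp_adMat_mul_exp {q : ℝ → Mat 𝔤} {y v : 𝔤} {t : ℝ} (hy : q t = adMat y)
    (hq : HasDerivAt q (adMat v) t) (x : 𝔤) :
    HasDerivAt (fun r : ℝ => exp (q r) * exp (r • adMat x))
      (exp (q t) * exp (t • adMat x) *
        adMat (x + matAct (meanExp y v) (exp (-(t • adMat x))))) t := by
  have h2 := hasDerivAt_exp_smul_const (𝕂 := ℝ) (adMat x) t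
  refine ((hasDerivAt_exp_adMat hy hq).mul h2).congr_deriv ?_
  have := exp_neg_mul_adMat_mul_exp (t • x) (meanExp y v)
  rw [map_smul] at this
  rw [map_add, ← this, mul_add, add_comm]
  congr 1
  · simp only [mul_assoc]
  · rw [mul_assoc, mul_assoc]
    congr 1
    rw [← mul_assoc, ← mul_assoc, exp_mul_exp_neg, one_mul]

theorem matAct_real_smul (r : ℝ) (v : 𝔤) (M : Mat 𝔤) : matAct (r • v) M = r • matAct v M := by
  rw [matAct_apply, matAct_apply, ← Complex.coe_smul, map_smul, Complex.coe_smul]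

/-- Separates vector and operator into finitely many products of scalars, so that regularity of
`matAct v M` in a parameter follows from that of each factor. -/
theorem apply_matAct_eq_sum (φ : 𝔤 →ₗ[ℂ] ℂ) (v : 𝔤) (M : Mat 𝔤) :
    φ (matAct v M) = ∑ j, (Module.finBasis ℂ 𝔤).coord j v *
      φ (matAct (Module.finBasis ℂ 𝔤 j) M) := by
  conv_lhs => rw [← (Module.finBasis ℂ 𝔤).sum_repr v]
  simp only [matAct_apply, map_sum, map_smul, smul_eq_mul, Module.Basis.coord_apply]

/-- A linear functional on `𝔤`, evaluated at the image of a vector, as a functional of the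
operator. -/
def matCoeff (φ : 𝔤 →ₗ[ℂ] ℂ) (v : 𝔤) : Mat 𝔤 →L[ℝ] ℂ :=
  LinearMap.toContinuousLinearMap ((φ.restrictScalars ℝ).comp (matAct v))

theorem matCoeff_apply (φ : 𝔤 →ₗ[ℂ] ℂ) (v : 𝔤) (M : Mat 𝔤) :
    matCoeff φ v M = φ (matAct v M) := rfl

theorem meanExp_smul (x v : 𝔤) (s : ℝ) : meanExp x (s • v) = s • meanExp x v :=
  matAct_real_smul _ _ _

theorem meanExp_zero (v : 𝔤) : meanExp 0 v = v := by
  simp [meanExp, matAct_one]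

theorem isC2Family_matAct_meanExp (φ : 𝔤 →ₗ[ℂ] ℂ) {y v : ℝ → 𝔤} {E : ℝ → Mat 𝔤}
    (hy : Continuous fun t => adMat (y t)) (hv : ∀ ψ : 𝔤 →ₗ[ℝ] ℂ, Continuous fun t => ψ (v t))
    (hE : Continuous E) :
    IsC2Family fun s t => φ (matAct (meanExp (s • y t) (v t)) (E t)) := by
  have h1 : IsC2Family fun s t => E t * ∫ τ in (0 : ℝ)..1, exp (s • (-(τ • adMat (y t)))) :=
    (isC2Family_const hE).mul ((isC2Family_exp_smul (A := fun p : ℝ × ℝ =>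
      -(p.2 • adMat (y p.1)))
      (continuous_snd.smul (hy.comp continuous_fst)).neg).integral 0 1)
  have h2 := IsC2Family.sum Finset.univ fun j _ =>
    (isC2Family_const (hv (((Module.finBasis ℂ 𝔤).coord j).restrictScalars ℝ))).mul
      (h1.clm_comp (matCoeff φ (Module.finBasis ℂ 𝔤 j)))
  refine (funext₂ fun s t => ?_ : _ = fun (s t : ℝ) =>
    φ (matAct (meanExp (s • y t) (v t)) (E t))) ▸ h2
  rw [meanExp, ← matAct_mul, apply_matAct_eq_sum]
  refine Finset.sum_congr rfl fun j _ => ?_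
  rw [matCoeff_apply]
  simp only [map_smul, smul_neg, smul_comm s, LinearMap.coe_restrictScalars]

theorem contDiff_exp_neg_smul (A : Mat 𝔤) {n : WithTop ℕ∞} :
    ContDiff ℝ n fun t : ℝ => exp (-(t • A)) := by
  have h : ContDiff ℝ n (exp : Mat 𝔤 → Mat 𝔤) :=
    contDiff_iff_contDiffAt.2 fun x => (exp_analytic (𝕂 := ℝ) x).contDiffAt
  exact h.comp (by fun_prop)

end Exponential

open LieAlgebra LieModule LieAlgebra.IsKilling

variable {𝔤 : Type*} [LieRing 𝔤] [LieAlgebra ℂ 𝔤] [FiniteDimensional ℂ 𝔤]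
  [LieAlgebra.IsSimple ℂ 𝔤] {H : LieSubalgebra ℂ 𝔤} [H.IsCartanSubalgebra]

/-! ### Roots and their reality -/

section Roots

theorem coe_negRoot (α : H.root) : ((negRoot α).1 : H → ℂ) = -(α.1 : H → ℂ) := rfl

theorem root_negRoot (α : H.root) :
    (rootSystem H).root (negRoot α) = -(rootSystem H).root α := rfl

theorem root_ext {α β : H.root} (h : (α.1 : H → ℂ) = (β.1 : H → ℂ)) : α = β :=
  Subtype.ext (DFunLike.coe_injective h)

@[simp]
theorem negRoot_negRoot (α : H.root) : negRoot (negRoot α) = α :=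
  root_ext (by rw [coe_negRoot, coe_negRoot, neg_neg])

theorem coe_root_ne_zero (α : H.root) : (α.1 : H → ℂ) ≠ 0 := fun h =>
  H.isNonZero_coe_root α h

theorem negRoot_ne_self (α : H.root) : negRoot α ≠ α := fun h => by
  have h1 : -(α.1 : H → ℂ) = (α.1 : H → ℂ) := by rw [← coe_negRoot, h]
  exact coe_root_ne_zero α (self_eq_neg.1 h1.symm)

theorem eq_negRoot_of_add_eq_zero {α β : H.root} (h : (α.1 : H → ℂ) + (β.1 : H → ℂ) = 0) :
    β = negRoot α :=
  root_ext (by rw [coe_negRoot]; exact eq_neg_of_add_eq_zero_right h)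

theorem not_isPos_negRoot (b : (rootSystem H).Base) {α : H.root} (h : b.IsPos α) :
    ¬ b.IsPos (negRoot α) := by
  have e : (rootSystem H).reflectionPerm α α = negRoot α :=
    (rootSystem H).root.injective (by 
      rw [RootPairing.root_reflectionPerm, RootPairing.reflection_apply_self, root_negRoot])
  rw [← e]
  exact fun h' => (RootPairing.Base.IsPos.neg_iff_not b α).1 h' h

variable (H) in
/-- A root space is orthogonal to the Cartan subalgebra. -/
theorem killingForm_mem_rootSpace_mem {α : H.root} {x h : 𝔤}
    (hx : x ∈ rootSpace H (α.1 : H → ℂ)) (hh : h ∈ H) : killingForm ℂ 𝔤 x h = 0 := by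
  have h0 : h ∈ rootSpace H (0 : H → ℂ) := by
    rw [rootSpace_zero_eq]; exact hh
  exact killingForm_apply_eq_zero_of_mem_rootSpace_of_add_ne_zero ℂ 𝔤 H hx h0
    (by rw [add_zero]; exact coe_root_ne_zero α)

theorem apply_coroot_real (β α : H.root) : ∃ c : ℝ, β.1 (coroot α.1) = c :=
  ⟨_, by rw [apply_coroot_eq_cast]; norm_cast⟩

/-- With `d = α(H_α)` the coroot is `(2/d) H_α`, and roots take integer values on coroots. The
Killing square of the coroot is therefore a sum of real squares; it equals `4/d`, so `d` is real
too. -/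
theorem apply_cartanEquivDual_symm_real (β α : H.root) :
    ∃ c : ℝ, β.1 ((cartanEquivDual H).symm α.1.toLinear) = c := by
  set d := α.1 ((cartanEquivDual H).symm α.1.toLinear) with hd
  have hd0 : d ≠ 0 := root_apply_cartanEquivDual_symm_ne_zero (H.isNonZero_coe_root α)
  have hself : α.1 (coroot α.1) = 2 := root_apply_coroot (H.isNonZero_coe_root α)
  have h1 : ∃ c : ℝ, traceForm ℂ H 𝔤 (coroot α.1) (coroot α.1) = c := by
    choose f hf using fun β : H.root => apply_coroot_real β α
    refine ⟨∑ β : H.root, f β * f β, ?_⟩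
    have h := congrArg (fun B => B (coroot α.1) (coroot α.1)) (restrict_killingForm_eq_sum (H := H))
    rw [← restrict_killingForm]
    refine h.trans ?_
    rw [← Finset.sum_coe_sort]
    simp only [LinearMap.sum_apply, LinearMap.smulRight_apply, LinearMap.smul_apply, smul_eq_mul]
    push_cast
    exact Finset.sum_congr rfl fun β _ => congrArg₂ (· * ·) (hf β) (hf β)
  obtain ⟨c, hc⟩ := h1
  rw [traceForm_coroot, hself, ← hd] at hc
  obtain ⟨c', hc'⟩ := apply_coroot_real β α
  have hb : β.1 (coroot α.1) = 2 * (d⁻¹ * β.1 ((cartanEquivDual H).symm α.1.toLinear)) := by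
    rw [← Weight.toLinear_apply, coroot, map_nsmul, map_smul]
    simp [hd]
  have hdc : d⁻¹ = ((c / 4 : ℝ) : ℂ) := by
    push_cast
    rw [← hc]
    simp
    ring
  have hc0 : c ≠ 0 := by
    rintro rfl
    simp [hd0] at hdc
  refine ⟨c' * (2 / c), ?_⟩
  rw [hc', hdc] at hb
  have : (c : ℂ) ≠ 0 := by exact_mod_cast hc0
  push_cast at hb ⊢
  rw [hb]
  field_simp
  norm_num

end Roots

/-! ### Brackets and pairings in a Weyl basis -/

namespace WeylBasis

variable (w : WeylBasis H)

theorem killingForm_X_X (α β : H.root) [Decidable (β = negRoot α)] :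
    killingForm ℂ 𝔤 (w.X α) (w.X β) = if β = negRoot α then 1 else 0 := by
  split_ifs with h
  · rw [h, w.killing_eq_one]
  · exact killingForm_apply_eq_zero_of_mem_rootSpace_of_add_ne_zero ℂ 𝔤 H (w.mem_rootSpace α)
      (w.mem_rootSpace β) fun h' => h (eq_negRoot_of_add_eq_zero h')

theorem lie_negRoot (α : H.root) :
    ⁅w.X α, w.X (negRoot α)⁆ = ((cartanEquivDual H).symm α.1.toLinear : H) := by
  rw [lie_eq_killingForm_smul_of_mem_rootSpace_of_mem_rootSpace_neg (w.mem_rootSpace α)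
    (w.mem_rootSpace (negRoot α)), w.killing_eq_one, one_smul]

theorem lie_eq_zero {α β : H.root} (h0 : (α.1 : H → ℂ) + (β.1 : H → ℂ) ≠ 0)
    (h : ∀ δ : H.root, (δ.1 : H → ℂ) ≠ (α.1 : H → ℂ) + (β.1 : H → ℂ)) :
    ⁅w.X α, w.X β⁆ = 0 := by
  by_contra hne
  have hm := lie_mem_genWeightSpace_of_mem_genWeightSpace (w.mem_rootSpace α) (w.mem_rootSpace β)
  let χ : Weight ℂ H 𝔤 := ⟨(α.1 : H → ℂ) + (β.1 : H → ℂ), fun hb => by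
    rw [hb, LieSubmodule.mem_bot] at hm
    exact hne hm⟩
  have hχ : χ ∈ H.root := by
    simp only [LieSubalgebra.root, Finset.mem_filter, Finset.mem_univ, true_and]
    exact h0
  exact h ⟨χ, hχ⟩ rfl

theorem lie_X_of_mem (α : H.root) (h : H) : ⁅(h : 𝔤), w.X α⁆ = α.1 h • w.X α :=
  lie_eq_smul_of_mem_rootSpace (w.mem_rootSpace α) h

end WeylBasis

/-! ### The compact real form is a Lie algebra -/

namespace FlagDatum

variable (D : FlagDatum H)

/-- The element `z X_α - \bar z X_{-α}` of the compact real form. -/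
def skew (α : H.root) (z : ℂ) : 𝔤 :=
  z • D.weyl.X α - (starRingEnd ℂ z) • D.weyl.X (negRoot α)

theorem skew_eq (α : H.root) (z : ℂ) : D.skew α z = z.re • D.A α + z.im • D.S α := by
  rw [skew, A, S, ← Complex.coe_smul, ← Complex.coe_smul z.im, smul_smul]
  conv_lhs => rw [← Complex.re_add_im z]
  simp only [map_add, map_mul, Complex.conj_ofReal, Complex.conj_I]
  module

theorem A_eq_skew (α : H.root) : D.A α = D.skew α 1 := by simp [skew_eq]

theorem S_eq_skew (α : H.root) : D.S α = D.skew α Complex.I := by simp [skew_eq]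

theorem coH_eq (α : H.root) : D.coH α = ((cartanEquivDual H).symm α.1.toLinear : H) := rfl

theorem A_mem_u (α : H.root) : D.A α ∈ D.u :=
  Submodule.subset_span (Or.inl (Or.inr ⟨α, rfl⟩))

theorem S_mem_u (α : H.root) : D.S α ∈ D.u := Submodule.subset_span (Or.inr ⟨α, rfl⟩)

theorem I_smul_coH_mem_u (α : H.root) : Complex.I • D.coH α ∈ D.u :=
  Submodule.subset_span (Or.inl (Or.inl ⟨α, rfl⟩))

theorem skew_mem_u (α : H.root) (z : ℂ) : D.skew α z ∈ D.u := by
  rw [skew_eq]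
  exact D.u.add_mem (D.u.smul_mem _ (D.A_mem_u α)) (D.u.smul_mem _ (D.S_mem_u α))

/-- An induction principle for the compact real form. -/
theorem u_induction {p : 𝔤 → Prop} (hH : ∀ α, p (Complex.I • D.coH α))
    (hskew : ∀ α z, p (D.skew α z)) (h0 : p 0) (hadd : ∀ x y, p x → p y → p (x + y))
    (hsmul : ∀ (r : ℝ) x, p x → p (r • x)) {x : 𝔤} (hx : x ∈ D.u) : p x := by
  unfold u at hx
  induction hx using Submodule.span_induction with
  | mem x hx =>
    rcases hx with (⟨α, rfl⟩ | ⟨α, rfl⟩) | ⟨α, rfl⟩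
    · exact hH α
    · rw [A_eq_skew]; exact hskew α 1
    · rw [S_eq_skew]; exact hskew α _
  | zero => exact h0
  | add x y _ _ hx hy => exact hadd x y hx hy
  | smul r x _ hx => exact hsmul r x hx

/-- This is where the Weyl normalization enters. If `α + β` is a root `δ`, reality of `m` and
`m_{-α,-β} = -m_{α,β}` give an element `skew δ`; if `α + β = 0`, a real multiple of `i H_α` remains;
otherwise both brackets vanish. -/
theorem smul_lie_add_conj_smul_lie_mem_u (α β : H.root) (z : ℂ) :
    z • ⁅D.weyl.X α, D.weyl.X β⁆ +
      (starRingEnd ℂ z) • ⁅D.weyl.X (negRoot α), D.weyl.X (negRoot β)⁆ ∈ D.u := by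
  by_cases h0 : (α.1 : H → ℂ) + (β.1 : H → ℂ) = 0
  · obtain rfl := eq_negRoot_of_add_eq_zero h0
    have e : z • ⁅D.weyl.X α, D.weyl.X (negRoot α)⁆ +
        (starRingEnd ℂ z) • ⁅D.weyl.X (negRoot α), D.weyl.X (negRoot (negRoot α))⁆ =
        (2 * z.im) • (Complex.I • D.coH α) := by
      rw [negRoot_negRoot, ← lie_skew (D.weyl.X (negRoot α)) (D.weyl.X α), D.weyl.lie_negRoot,
        ← coH_eq, smul_neg, ← sub_eq_add_neg, ← sub_smul, Complex.sub_conj, ← Complex.coe_smul,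
        smul_smul]
    rw [e]
    exact D.u.smul_mem _ (D.I_smul_coH_mem_u α)
  by_cases h : ∃ δ : H.root, (δ.1 : H → ℂ) = (α.1 : H → ℂ) + (β.1 : H → ℂ)
  · obtain ⟨δ, hδ⟩ := h
    have hδ' : ((negRoot δ).1 : H → ℂ) =
        ((negRoot α).1 : H → ℂ) + ((negRoot β).1 : H → ℂ) := by
      rw [coe_negRoot, coe_negRoot, coe_negRoot, hδ, neg_add]
    have e : z • ⁅D.weyl.X α, D.weyl.X β⁆ +
        (starRingEnd ℂ z) • ⁅D.weyl.X (negRoot α), D.weyl.X (negRoot β)⁆ =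
        D.skew δ (z * D.weyl.m α β) := by
      rw [D.weyl.lie_eq α β δ hδ, D.weyl.lie_eq _ _ _ hδ', D.weyl.m_neg, skew, map_mul,
        Complex.conj_ofReal]
      push_cast
      module
    rw [e]
    exact D.skew_mem_u _ _
  · push Not at h
    have h0' : ((negRoot α).1 : H → ℂ) + ((negRoot β).1 : H → ℂ) ≠ 0 := by
      rw [coe_negRoot, coe_negRoot, ← neg_add]
      exact neg_ne_zero.2 h0
    have h' : ∀ δ : H.root, (δ.1 : H → ℂ) ≠
        ((negRoot α).1 : H → ℂ) + ((negRoot β).1 : H → ℂ) := by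
      intro δ hδ
      refine h (negRoot δ) ?_
      rw [coe_negRoot, hδ, coe_negRoot, coe_negRoot, ← neg_add, neg_neg]
    rw [D.weyl.lie_eq_zero h0 h, D.weyl.lie_eq_zero h0' h', smul_zero, smul_zero, add_zero]
    exact D.u.zero_mem

theorem lie_skew_skew_mem_u (α β : H.root) (z w : ℂ) : ⁅D.skew α z, D.skew β w⁆ ∈ D.u := by
  have h1 := D.smul_lie_add_conj_smul_lie_mem_u α β (z * w)
  have h2 := D.smul_lie_add_conj_smul_lie_mem_u α (negRoot β) (z * starRingEnd ℂ w)
  rw [negRoot_negRoot] at h2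
  have e := D.u.sub_mem h1 h2
  convert e using 1
  simp only [skew, sub_lie, lie_sub, smul_lie, lie_smul, map_mul, Complex.conj_conj]
  module

/-- Since `c = β(H_α)` is real, `i H_α` multiplies the coordinate `z` by `i c`, and the `X_{-β}`
coefficient follows by conjugation. -/
theorem lie_coH_skew_mem_u (α β : H.root) (z : ℂ) :
    ⁅Complex.I • D.coH α, D.skew β z⁆ ∈ D.u := by
  obtain ⟨c, hc⟩ := apply_cartanEquivDual_symm_real β α
  have e : ⁅Complex.I • D.coH α, D.skew β z⁆ = D.skew β (Complex.I * c * z) := by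
    have h2 : (negRoot β).1 ((cartanEquivDual H).symm α.1.toLinear) = -(c : ℂ) := by
      rw [← hc]; rfl
    rw [skew, skew, lie_sub, smul_lie, smul_lie, lie_smul, lie_smul, coH_eq, D.weyl.lie_X_of_mem,
      D.weyl.lie_X_of_mem, hc, h2]
    simp only [map_mul, Complex.conj_I, Complex.conj_ofReal]
    module
  rw [e]
  exact D.skew_mem_u _ _

theorem lie_mem_u {x y : 𝔤} (hx : x ∈ D.u) (hy : y ∈ D.u) : ⁅x, y⁆ ∈ D.u := by
  refine D.u_induction (p := fun x => ⁅x, y⁆ ∈ D.u) (fun α => ?_) (fun α z => ?_) (by simp)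
    (fun a b ha hb => by rw [add_lie]; exact D.u.add_mem ha hb)
    (fun r a ha => by rw [← Complex.coe_smul, smul_lie, Complex.coe_smul]
                      exact D.u.smul_mem r ha) hx
  all_goals
    refine D.u_induction (p := fun y => ⁅_, y⁆ ∈ D.u) (fun β => ?_) (fun β w => ?_) (by simp)
      (fun a b ha hb => by rw [lie_add]; exact D.u.add_mem ha hb)
      (fun r a ha => by rw [← Complex.coe_smul, lie_smul, Complex.coe_smul]
                        exact D.u.smul_mem r ha) hy
  · have h0 : ⁅D.coH α, D.coH β⁆ = 0 := by
      rw [coH_eq, coH_eq, ← LieSubalgebra.coe_bracket, trivial_lie_zero, ZeroMemClass.coe_zero]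
    simp [h0]
  · exact D.lie_coH_skew_mem_u α β w
  · rw [← lie_skew]
    exact D.u.neg_mem (D.lie_coH_skew_mem_u β α z)
  · exact D.lie_skew_skew_mem_u α β z w

/-! ### Components along root vectors -/

theorem killingForm_X_coH (α β : H.root) : killingForm ℂ 𝔤 (D.weyl.X α) (D.coH β) = 0 :=
  killingForm_mem_rootSpace_mem H (D.weyl.mem_rootSpace α) (by rw [coH_eq]; exact Subtype.coe_prop _)

open Classical in
theorem killingForm_X_skew (α β : H.root) (z : ℂ) :
    killingForm ℂ 𝔤 (D.weyl.X α) (D.skew β z) =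
      (if β = negRoot α then z else 0) - (if β = α then starRingEnd ℂ z else 0) := by
  have h : negRoot β = negRoot α ↔ β = α :=
    ⟨fun h => by rw [← negRoot_negRoot β, h, negRoot_negRoot], fun h => by rw [h]⟩
  rw [skew, map_sub, map_smul, map_smul, D.weyl.killingForm_X_X, D.weyl.killingForm_X_X]
  simp only [h, smul_eq_mul, mul_ite, mul_one, mul_zero]

/-- The reality condition on `𝔲`: the components along `±α` determine each other, so one complex
number per positive root suffices. -/
theorem killingForm_X_negRoot {Y : 𝔤} (hY : Y ∈ D.u) (α : H.root) :
    killingForm ℂ 𝔤 (D.weyl.X (negRoot α)) Y =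
      -starRingEnd ℂ (killingForm ℂ 𝔤 (D.weyl.X α) Y) := by
  classical
  refine D.u_induction (p := fun Y => killingForm ℂ 𝔤 (D.weyl.X (negRoot α)) Y =
      -starRingEnd ℂ (killingForm ℂ 𝔤 (D.weyl.X α) Y)) (fun β => ?_) (fun β z => ?_) (by simp)
      (fun x y hx hy => ?_) (fun r x hx => ?_) hY
  · simp [killingForm_X_coH]
  · rw [killingForm_X_skew, killingForm_X_skew, negRoot_negRoot, map_sub]
    split_ifs <;> simp
  · rw [map_add, map_add, hx, hy, map_add, neg_add]
  · rw [← Complex.coe_smul, map_smul, map_smul, hx]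
    simp

theorem proj_eq_skew {Y : 𝔤} (hY : Y ∈ D.u) (α : H.root) :
    D.proj α Y = D.skew α (-starRingEnd ℂ (killingForm ℂ 𝔤 (D.weyl.X α) Y)) := by
  simp [proj, skew, D.killingForm_X_negRoot hY]

theorem skew_mem_uRoot (α : H.root) (z : ℂ) : D.skew α z ∈ D.uRoot α := by
  rw [skew_eq]
  exact (D.uRoot α).add_mem ((D.uRoot α).smul_mem _ (Submodule.subset_span (by simp)))
    ((D.uRoot α).smul_mem _ (Submodule.subset_span (by simp)))

theorem projSum_apply (σ : Finset H.root) (Y : 𝔤) : D.projSum σ Y = ∑ α ∈ σ, D.proj α Y := by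
  simp [projSum]

theorem projSum_mem_mSum {Y : 𝔤} (hY : Y ∈ D.u) (σ : Finset H.root) :
    D.projSum σ Y ∈ D.mSum σ := by
  rw [projSum_apply]
  refine Submodule.sum_mem _ fun α hα => ?_
  rw [D.proj_eq_skew hY]
  exact Submodule.mem_iSup_of_mem α (Submodule.mem_iSup_of_mem hα (D.skew_mem_uRoot _ _))

theorem isPos_of_mem_mRoots {α : H.root} (h : α ∈ D.mRoots) : D.base.IsPos α := by
  classical
  unfold mRoots at h
  exact (Finset.mem_filter.1 h).2.1

theorem notMem_thetaRoots_of_mem_mRoots {α : H.root} (h : α ∈ D.mRoots) : α ∉ D.thetaRoots := by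
  classical
  unfold mRoots at h
  exact (Finset.mem_filter.1 h).2.2

theorem ne_negRoot_of_mem_mRoots {α β : H.root} (hα : α ∈ D.mRoots) (hβ : β ∈ D.mRoots) :
    α ≠ negRoot β := fun h =>
  not_isPos_negRoot D.base (D.isPos_of_mem_mRoots hβ) (h ▸ D.isPos_of_mem_mRoots hα)

variable {D}

section ProjSum

variable {σ : Finset H.root}

theorem killingForm_X_projSum (hσ : σ ⊆ D.mRoots) {α : H.root} (hα : α ∈ σ) (Y : 𝔤) :
    killingForm ℂ 𝔤 (D.weyl.X α) (D.projSum σ Y) = killingForm ℂ 𝔤 (D.weyl.X α) Y := by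
  classical
  rw [projSum_apply, map_sum, Finset.sum_eq_single_of_mem α hα]
  · simp [proj, D.weyl.killingForm_X_X, (negRoot_ne_self α).symm]
  · intro β hβ hne
    have h1 : β ≠ negRoot α := D.ne_negRoot_of_mem_mRoots (hσ hβ) (hσ hα)
    have h2 : negRoot β ≠ negRoot α := fun h => hne (by
      rw [← negRoot_negRoot β, h, negRoot_negRoot])
    simp [proj, D.weyl.killingForm_X_X, h1, h2]

theorem killingForm_X_negRoot_projSum (hσ : σ ⊆ D.mRoots) {α : H.root} (hα : α ∈ σ) (Y : 𝔤) :
    killingForm ℂ 𝔤 (D.weyl.X (negRoot α)) (D.projSum σ Y) =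
      killingForm ℂ 𝔤 (D.weyl.X (negRoot α)) Y := by
  classical
  rw [projSum_apply, map_sum, Finset.sum_eq_single_of_mem α hα]
  · simp [proj, D.weyl.killingForm_X_X, negRoot_ne_self α]
  · intro β hβ hne
    have h1 : negRoot β ≠ α := fun h => D.ne_negRoot_of_mem_mRoots (hσ hα) (hσ hβ) h.symm
    simp [proj, D.weyl.killingForm_X_X, h1, hne]

theorem projSum_congr {Y Z : 𝔤}
    (h : ∀ α ∈ σ, killingForm ℂ 𝔤 (D.weyl.X α) Y = killingForm ℂ 𝔤 (D.weyl.X α) Z)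
    (h' : ∀ α ∈ σ, killingForm ℂ 𝔤 (D.weyl.X (negRoot α)) Y =
      killingForm ℂ 𝔤 (D.weyl.X (negRoot α)) Z) : D.projSum σ Y = D.projSum σ Z := by
  rw [projSum_apply, projSum_apply]
  refine Finset.sum_congr rfl fun α hα => ?_
  simp [proj, h α hα, h' α hα]

/-- Root vectors pair only with their opposites. Both `X_α` and `X_{-α}` contribute the same amount,
whence the factor 2. -/
theorem killingForm_projSum_projSum (hσ : σ ⊆ D.mRoots) {Y : 𝔤} (hY : Y ∈ D.u) :
    (killingForm ℂ 𝔤 (D.projSum σ Y) (D.projSum σ Y)).re =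
      -∑ α ∈ σ, 2 * Complex.normSq (killingForm ℂ 𝔤 (D.weyl.X α) Y) := by
  have e : killingForm ℂ 𝔤 (D.projSum σ Y) (D.projSum σ Y) =
      ∑ α ∈ σ, -(2 * (Complex.normSq (killingForm ℂ 𝔤 (D.weyl.X α) Y) : ℂ)) := by
    conv_lhs => enter [1]; rw [projSum_apply]
    rw [map_sum, LinearMap.sum_apply]
    refine Finset.sum_congr rfl fun α hα => ?_
    simp only [proj, LinearMap.add_apply, LinearMap.smulRight_apply, map_add, map_smul,
      LinearMap.smul_apply, killingForm_X_projSum hσ hα, killingForm_X_negRoot_projSum hσ hα,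
      D.killingForm_X_negRoot hY, smul_eq_mul, Complex.normSq_eq_conj_mul_self]
    ring
  rw [e, ← Finset.sum_neg_distrib, Complex.re_sum]
  refine Finset.sum_congr rfl fun α _ => ?_
  norm_cast

theorem projSum_eq_self (hσ : σ ⊆ D.mRoots) {v : 𝔤} (hv : v ∈ D.mSum σ) : D.projSum σ v = v := by
  classical
  suffices h : D.mSum σ ≤ LinearMap.eqLocus ((D.projSum σ).restrictScalars ℝ) LinearMap.id from h hv
  have key : ∀ α ∈ σ, ∀ z, D.projSum σ (D.skew α z) = D.skew α z := by
    intro α hα z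
    rw [projSum_apply, Finset.sum_eq_single_of_mem α hα]
    · rw [D.proj_eq_skew (D.skew_mem_u _ _), killingForm_X_skew]
      simp [(negRoot_ne_self α).symm]
    · intro β hβ hne
      rw [D.proj_eq_skew (D.skew_mem_u _ _), killingForm_X_skew]
      simp [D.ne_negRoot_of_mem_mRoots (hσ hα) (hσ hβ), hne.symm, skew]
  refine iSup₂_le fun α hα => Submodule.span_le.2 ?_
  rintro x (rfl | rfl)
  · change D.projSum σ (D.A α) = D.A α
    rw [A_eq_skew]; exact key α hα _
  · change D.projSum σ (D.S α) = D.S α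
    rw [S_eq_skew]; exact key α hα _

end ProjSum

theorem subset_mRoots_of_mem_components {σ : Finset H.root} (h : σ ∈ D.components) :
    σ ⊆ D.mRoots := by
  classical
  unfold components at h
  exact Finset.mem_powerset.1 (Finset.mem_filter.1 h).1

theorem isotropyInvariant_of_mem_components {σ : Finset H.root} (h : σ ∈ D.components) :
    D.IsotropyInvariant (D.mSum σ) := by
  classical
  unfold components at h
  exact (Finset.mem_filter.1 h).2.2.1

/-- The scalar product of an invariant metric in terms of the components along root vectors. -/
theorem InvariantMetric.B_projM (Λ : D.InvariantMetric) {Y : 𝔤} (hY : Y ∈ D.u) :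
    Λ.B (D.projM Y) (D.projM Y) = ∑ σ : D.components, Λ.coeff σ *
      ∑ α ∈ σ.1, 2 * Complex.normSq (killingForm ℂ 𝔤 (D.weyl.X α) Y) := by
  rw [InvariantMetric.B, ← Finset.sum_neg_distrib]
  refine Finset.sum_congr rfl fun σ _ => ?_
  have hσ := subset_mRoots_of_mem_components σ.2
  have e : D.projSum σ.1 (D.projM Y) = D.projSum σ.1 Y :=
    projSum_congr (fun α hα => killingForm_X_projSum subset_rfl (hσ hα) Y)
      (fun α hα => killingForm_X_negRoot_projSum subset_rfl (hσ hα) Y)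
  rw [e, killingForm_projSum_projSum hσ hY]
  ring

variable (D)

/-! ### The adjoint action of the compact group -/

theorem Ad_mul (g h : D.U) (y : 𝔤) : D.Ad (g * h) y = D.Ad g (D.Ad h y) := rfl

theorem Ad_one (y : 𝔤) : D.Ad 1 y = y := rfl

theorem Ad_Ad_inv (g : D.U) (y : 𝔤) : D.Ad g (D.Ad g⁻¹ y) = y := by
  rw [← Ad_mul, mul_inv_cancel, Ad_one]

theorem Ad_exp (Y : D.u) (y : 𝔤) :
    D.Ad (D.exp Y) y = matAct y (NormedSpace.exp (adMat (Y : 𝔤))) := expAd_apply _ _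

theorem Ad_lie (g : D.U) (y z : 𝔤) : D.Ad g ⁅y, z⁆ = ⁅D.Ad g y, D.Ad g z⁆ := by
  obtain ⟨g, hg⟩ := g
  change g.1 ⁅y, z⁆ = ⁅g.1 y, g.1 z⁆
  unfold U at hg
  induction hg using Subgroup.closure_induction generalizing y z with
  | mem g hg =>
    obtain ⟨x, -, rfl⟩ := hg
    exact expAd_lie x y z
  | one => rfl
  | mul a b _ _ ha hb =>
    change a.1 (b.1 _) = ⁅a.1 (b.1 _), a.1 (b.1 _)⁆
    rw [hb, ha]
  | inv a _ ha =>
    have hl : ∀ v, a⁻¹.1 (a.1 v) = v := fun v => LinearMap.congr_fun a.inv_mul v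
    have hr : ∀ v, a.1 (a⁻¹.1 v) = v := fun v => LinearMap.congr_fun a.mul_inv v
    rw [← hl ⁅a⁻¹.1 y, a⁻¹.1 z⁆, ha, hr, hr]

theorem killingForm_Ad_Ad (g : D.U) (y z : 𝔤) :
    killingForm ℂ 𝔤 (D.Ad g y) (D.Ad g z) = killingForm ℂ 𝔤 y z :=
  killingForm_map_of_map_lie g.1 (D.Ad_lie g) y z

theorem adMat_mem_matStabilizer {x : 𝔤} (hx : x ∈ D.u) : adMat x ∈ matStabilizer D.u :=
  fun v hv => by rw [matAct_adMat]; exact D.lie_mem_u hx hv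

theorem Ad_mem_u (g : D.U) {y : 𝔤} (hy : y ∈ D.u) : D.Ad g y ∈ D.u := by
  -- The inverse is carried along so that the induction over the generated subgroup closes under
  -- inversion.
  suffices h : ∀ y ∈ D.u, g.1.1 y ∈ D.u ∧ g.1⁻¹.1 y ∈ D.u from (h y hy).1
  clear hy y
  obtain ⟨g, hg⟩ := g
  simp only
  unfold U at hg
  induction hg using Subgroup.closure_induction with
  | mem g hg =>
    obtain ⟨x, hx, rfl⟩ := hg
    intro y hy
    rw [← coe_expAd_neg, expAd_apply, expAd_apply]
    exact ⟨exp_mem_matStabilizer (D.adMat_mem_matStabilizer hx) y hy,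
      exp_mem_matStabilizer (D.adMat_mem_matStabilizer (D.u.neg_mem hx)) y hy⟩
  | one => exact fun y hy => ⟨hy, by simpa using hy⟩
  | mul a b _ _ ha hb =>
    intro y hy
    rw [mul_inv_rev]
    exact ⟨(ha _ (hb _ hy).1).1, (hb _ (ha _ hy).2).2⟩
  | inv a _ ha => exact fun y hy => ⟨(ha y hy).2, by rw [inv_inv]; exact (ha y hy).1⟩

/-! ### The isotropy group -/

/-- Only `𝔤_{-α}` pairs nontrivially with `X_α`, and it is not a summand of the parabolic: `-α` is
neither positive nor spanned by `Θ`. -/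
theorem killingForm_X_parabolic {α : H.root} (hα : α ∈ D.mRoots) {p : 𝔤}
    (hp : p ∈ D.parabolic) : killingForm ℂ 𝔤 (D.weyl.X α) p = 0 := by
  suffices h : D.parabolic ≤ LinearMap.ker (killingForm ℂ 𝔤 (D.weyl.X α)) from h hp
  have key : ∀ β : H.root, β ≠ negRoot α →
      (rootSpace H (β.1 : H → ℂ)).toSubmodule ≤ LinearMap.ker (killingForm ℂ 𝔤 (D.weyl.X α)) :=
    fun β hβ x hx => killingForm_apply_eq_zero_of_mem_rootSpace_of_add_ne_zero ℂ 𝔤 H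
      (D.weyl.mem_rootSpace α) hx fun h => hβ (eq_negRoot_of_add_eq_zero h)
  refine sup_le (sup_le (fun h hh => ?_) (iSup_le fun β => key _ ?_)) (iSup_le fun β => key _ ?_)
  · exact killingForm_mem_rootSpace_mem H (D.weyl.mem_rootSpace α) hh
  · intro h
    have hβ := β.2.1
    rw [h] at hβ
    refine D.notMem_thetaRoots_of_mem_mRoots hα ?_
    unfold thetaRoots at hβ ⊢
    rw [mem_ofPred_eq, root_negRoot] at hβ
    exact (Submodule.neg_mem_iff _).1 hβ
  · intro h
    exact not_isPos_negRoot D.base (D.isPos_of_mem_mRoots hα) (h ▸ β.2)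

theorem mem_parabolic_of_mem {h : 𝔤} (hh : h ∈ H) : h ∈ D.parabolic :=
  Submodule.mem_sup_left (Submodule.mem_sup_left hh)

variable {D}

theorem Ad_mem_parabolic {k : D.U} (hk : k ∈ D.K) {p : 𝔤} (hp : p ∈ D.parabolic) :
    D.Ad k p ∈ D.parabolic := by
  have h : D.parabolic.map (k.1.1 : 𝔤 →ₗ[ℂ] 𝔤) = D.parabolic := hk
  rw [← h]
  exact Submodule.mem_map_of_mem hp

theorem inv_mul_mem_K {g g' : D.U} (h : g • D.origin = g' • D.origin) : g⁻¹ * g' ∈ D.K := by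
  have h' : ((g * 1 : D.U) : D.U ⧸ D.K) = ((g' * 1 : D.U) : D.U ⧸ D.K) := h
  rw [mul_one, mul_one] at h'
  exact QuotientGroup.eq.1 h'

theorem killingForm_mSum_eq_zero {σ : Finset H.root} {W : 𝔤}
    (h : ∀ α ∈ σ, killingForm ℂ 𝔤 (D.weyl.X α) W = 0)
    (h' : ∀ α ∈ σ, killingForm ℂ 𝔤 (D.weyl.X (negRoot α)) W = 0) {v : 𝔤} (hv : v ∈ D.mSum σ) :
    killingForm ℂ 𝔤 v W = 0 := by
  suffices h : D.mSum σ ≤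
      LinearMap.ker (((killingForm ℂ 𝔤).flip W).restrictScalars ℝ) from h hv
  refine iSup₂_le fun α hα => Submodule.span_le.2 ?_
  rintro x (rfl | rfl)
  · change killingForm ℂ 𝔤 (D.A α) W = 0
    simp [A, h α hα, h' α hα]
  · change killingForm ℂ 𝔤 (D.S α) W = 0
    simp [S, h α hα, h' α hα]

theorem killingForm_X_eq_zero {σ : Finset H.root} {W : 𝔤}
    (h : ∀ v ∈ D.mSum σ, killingForm ℂ 𝔤 v W = 0) {α : H.root} (hα : α ∈ σ) :
    killingForm ℂ 𝔤 (D.weyl.X α) W = 0 ∧ killingForm ℂ 𝔤 (D.weyl.X (negRoot α)) W = 0 := by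
  have hmem : ∀ z, D.skew α z ∈ D.mSum σ := fun z =>
    Submodule.mem_iSup_of_mem α (Submodule.mem_iSup_of_mem hα (D.skew_mem_uRoot α z))
  have h1 := h _ (hmem 1)
  have h2 := h _ (hmem Complex.I)
  simp only [skew, map_one, one_smul, map_sub, LinearMap.sub_apply, map_smul,
    LinearMap.smul_apply, Complex.conj_I, smul_eq_mul, neg_mul, sub_neg_eq_add,
    ← mul_add, mul_eq_zero, Complex.I_ne_zero, false_or] at h1 h2
  constructor
  · linear_combination (h1 + h2) / 2
  · linear_combination (h2 - h1) / 2

/-- `Ad k` preserves `𝔪_σ` and the Killing form, hence also the orthogonal complement of `𝔪_σ`, in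
which `Y - projSum σ Y` lies. -/
theorem projSum_Ad {k : D.U} (hk : k ∈ D.K) {σ : Finset H.root} (hσ : σ ∈ D.components) {Y : 𝔤}
    (hY : Y ∈ D.u) : D.projSum σ (D.Ad k Y) = D.Ad k (D.projSum σ Y) := by
  have hm := subset_mRoots_of_mem_components hσ
  have hinv := isotropyInvariant_of_mem_components hσ
  set Z := Y - D.projSum σ Y with hZ
  have h0 : ∀ v ∈ D.mSum σ, killingForm ℂ 𝔤 v (D.Ad k Z) = 0 := by
    intro v hv
    rw [← D.Ad_Ad_inv k v, killingForm_Ad_Ad]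
    refine killingForm_mSum_eq_zero (fun α hα => ?_) (fun α hα => ?_)
      (hinv _ (D.K.inv_mem hk) v hv)
    · rw [hZ, map_sub, killingForm_X_projSum hm hα, sub_self]
    · rw [hZ, map_sub, killingForm_X_negRoot_projSum hm hα, sub_self]
  have h1 : D.projSum σ (D.Ad k Z) = D.projSum σ 0 :=
    projSum_congr (fun α hα => by rw [(killingForm_X_eq_zero h0 hα).1, map_zero])
      (fun α hα => by rw [(killingForm_X_eq_zero h0 hα).2, map_zero])
  rw [map_zero] at h1
  have h2 : D.Ad k Y = D.Ad k (D.projSum σ Y) + D.Ad k Z := by rw [← map_add, hZ]; simp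
  rw [h2, map_add, h1, add_zero,
    projSum_eq_self hm (hinv k hk _ (D.projSum_mem_mSum hY σ))]

/-- The scalar product of an invariant metric is invariant under the isotropy representation. -/
theorem InvariantMetric.B_projM_Ad (Λ : D.InvariantMetric) {k : D.U} (hk : k ∈ D.K) {Y : 𝔤}
    (hY : Y ∈ D.u) :
    Λ.B (D.projM (D.Ad k Y)) (D.projM (D.Ad k Y)) = Λ.B (D.projM Y) (D.projM Y) := by
  rw [Λ.B_projM (D.Ad_mem_u k hY), Λ.B_projM hY]
  refine Finset.sum_congr rfl fun σ _ => ?_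
  have hm := subset_mRoots_of_mem_components σ.2
  have h1 := killingForm_projSum_projSum hm (D.Ad_mem_u k hY)
  rw [projSum_Ad hk σ.2 hY, killingForm_Ad_Ad, killingForm_projSum_projSum hm hY] at h1
  rw [neg_inj.1 h1]

/-! ### Velocities -/

/-- The left logarithmic derivatives of two lifts of a curve agree modulo the isotropy algebra. -/
theorem killingForm_X_eq_of_lifts {h h' : ℝ → D.U} {t : ℝ} {Y Y' : 𝔤}
    (heq : ∀ᶠ r in 𝓝 t, h r • D.origin = h' r • D.origin)
    (hd : ∀ y : 𝔤, HasCurveDerivAt (fun r => D.Ad (h r) y) (D.Ad (h t) ⁅Y, y⁆) t)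
    (hd' : ∀ y : 𝔤, HasCurveDerivAt (fun r => D.Ad (h' r) y) (D.Ad (h' t) ⁅Y', y⁆) t)
    {α : H.root} (hα : α ∈ D.mRoots) :
    killingForm ℂ 𝔤 (D.weyl.X α) (D.Ad ((h t)⁻¹ * h' t) Y') =
      killingForm ℂ 𝔤 (D.weyl.X α) Y := by
  set k := (h t)⁻¹ * h' t with hk
  have hkK : k ∈ D.K := inv_mul_mem_K heq.self_of_nhds
  have hh' : h' t = h t * k := by rw [hk, mul_inv_cancel_left]
  clear_value k
  set Z := D.Ad k Y' - Y with hZ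
  -- For fixed `p` in the parabolic, `(X_α, Ad(h⁻¹h') p)` vanishes near `t` because `h⁻¹h'` takes
  -- values in `K`. Its derivative at `t` is `(X_α, [Z, w])` with `w = Ad(k) p`. No Lie group
  -- structure on `K` is needed.
  have hpar : ∀ w ∈ D.parabolic, killingForm ℂ 𝔤 (D.weyl.X α) ⁅Z, w⁆ = 0 := by
    intro w hw
    set p := D.Ad k⁻¹ w with hp
    have hpp : p ∈ D.parabolic := Ad_mem_parabolic (D.K.inv_mem hkK) hw
    have hder := (hd (D.weyl.X α)).bilinear (hd' p) (killingForm ℂ 𝔤)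
    have hzero : (fun r => killingForm ℂ 𝔤 (D.Ad (h r) (D.weyl.X α)) (D.Ad (h' r) p)) =ᶠ[𝓝 t]
        fun _ => 0 := by
      filter_upwards [heq] with r hr
      have e : h' r = h r * ((h r)⁻¹ * h' r) := by rw [mul_inv_cancel_left]
      rw [e, Ad_mul, killingForm_Ad_Ad]
      exact D.killingForm_X_parabolic hα (Ad_mem_parabolic (inv_mul_mem_K hr) hpp)
    have h0 := hder.unique ((hasDerivAt_const t (0 : ℂ)).congr_of_eventuallyEq hzero)
    rw [hh', Ad_mul, Ad_mul, killingForm_Ad_Ad, killingForm_Ad_Ad, D.Ad_lie k, hp, Ad_Ad_inv,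
      ← lie_skew, map_neg, LinearMap.neg_apply, traceForm_apply_lie_apply] at h0
    rw [hZ, sub_lie, map_sub]
    linear_combination h0
  -- Taking `w = x` in the Cartan subalgebra turns the pairing into `α(x) (X_α, Z)`, up to sign, so
  -- `(X_α, Z) = 0`.
  obtain ⟨x, hx⟩ : ∃ x : H, α.1 x ≠ 0 :=
    ⟨coroot α.1, by rw [root_apply_coroot (H.isNonZero_coe_root α)]; exact two_ne_zero⟩
  have h1 := hpar x (D.mem_parabolic_of_mem x.2)
  rw [← lie_skew, map_neg, ← traceForm_apply_lie_apply, ← lie_skew, D.weyl.lie_X_of_mem,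
    map_neg, LinearMap.neg_apply, neg_neg, map_smul, LinearMap.smul_apply, smul_eq_mul] at h1
  have h2 := (mul_eq_zero.1 h1).resolve_left hx
  rw [hZ, map_sub] at h2
  exact sub_eq_zero.1 h2

/-- Makes the choice in `speedSq` harmless: passing to another lift acts on the velocity by an
isotropy element, which preserves the scalar product. -/
theorem HasVelocity.B_eq (Λ : D.InvariantMetric) {c : ℝ → D.Flag} {t : ℝ} {g g' : D.U} {v v' : 𝔤}
    (h : D.HasVelocity c t g v) (h' : D.HasVelocity c t g' v') : Λ.B v v = Λ.B v' v' := by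
  obtain ⟨l, hl, rfl, Y, hY, hd, rfl⟩ := h
  obtain ⟨l', hl', rfl, Y', hY', hd', rfl⟩ := h'
  have heq : ∀ᶠ r in 𝓝 t, l r • D.origin = l' r • D.origin := by
    filter_upwards [hl, hl'] with r h₁ h₂
    rw [← h₁, h₂]
  rw [← Λ.B_projM_Ad (inv_mul_mem_K heq.self_of_nhds) hY', Λ.B_projM hY,
    Λ.B_projM (D.Ad_mem_u _ hY')]
  refine Finset.sum_congr rfl fun σ _ => ?_
  congr 1
  refine Finset.sum_congr rfl fun α hα => ?_
  rw [killingForm_X_eq_of_lifts heq hd hd' (subset_mRoots_of_mem_components σ.2 hα)]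

theorem HasVelocity.speedSq_eq (Λ : D.InvariantMetric) {c : ℝ → D.Flag} {t : ℝ} {g : D.U} {v : 𝔤}
    (h : D.HasVelocity c t g v) : Λ.speedSq c t = Λ.B v v := by
  have hex : ∃ p : D.U × 𝔤, D.HasVelocity c t p.1 p.2 := ⟨(g, v), h⟩
  rw [InvariantMetric.speedSq, dif_pos hex]
  exact hex.choose_spec.B_eq Λ h

theorem hasVelocity_homCurve (X : D.u) (t : ℝ) :
    D.HasVelocity (D.homCurve X) t (D.exp (t • X)) (D.projM X) := by
  refine ⟨fun r => D.exp (r • X), Eventually.of_forall fun r => rfl, rfl, X, X.2, fun y => ?_, rfl⟩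
  have h := hasCurveDerivAt_linearMap (hasDerivAt_exp_smul_const (𝕂 := ℝ) (adMat (X : 𝔤)) t)
    (matAct y)
  rw [matAct_mul, matAct_adMat] at h
  simpa only [Ad_exp, Submodule.coe_smul, map_smul] using h

/-- The left logarithmic derivative of the lift `exp(s q(t)) exp(tX)` of a variation, where `q`
has the value `y` and the derivative `v` at `t`. -/
def variationVelocity (X y v : 𝔤) (s t : ℝ) : 𝔤 :=
  X + matAct (meanExp (s • y) (s • v)) (NormedSpace.exp (-(t • adMat X)))

theorem variationVelocity_mem_u {X y v : 𝔤} (hX : X ∈ D.u) (hy : y ∈ D.u) (hv : v ∈ D.u)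
    (s t : ℝ) : variationVelocity X y v s t ∈ D.u := by
  refine D.u.add_mem hX ?_
  refine exp_mem_matStabilizer (Submodule.neg_mem _ (Submodule.smul_mem _ _
    (D.adMat_mem_matStabilizer hX))) _ ?_
  exact integral_exp_mem_matStabilizer (D.adMat_mem_matStabilizer (D.u.smul_mem s hy)) _
    (D.u.smul_mem s hv)

theorem hasVelocity_variationOf (X : D.u) {q : ℝ → D.u} {v : D.u} {t : ℝ}
    (hq : HasCurveDerivAt q v t) (s : ℝ) :
    D.HasVelocity (D.variationOf X q s) t (D.exp (s • q t) * D.exp (t • X))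
      (D.projM (variationVelocity (X : 𝔤) (q t : 𝔤) (v : 𝔤) s t)) := by
  refine ⟨fun r => D.exp (s • q r) * D.exp (r • X), Eventually.of_forall fun r => ?_, rfl, _,
    variationVelocity_mem_u X.2 (q t).2 v.2 s t, fun y => ?_, rfl⟩
  · exact (mul_smul _ _ _).symm
  · have hQ : HasDerivAt (fun r => adMat ((s • q r : D.u) : 𝔤)) (adMat (s • (v : 𝔤))) t := by
      have := (hq.linearMap ((adMat (𝔤 := 𝔤)).comp D.u.subtype)).const_smul s
      simpa [Pi.smul_def] using this
    have h := hasCurveDerivAt_linearMap (hasDerivAt_exp_adMat_mul_exp (y := s • (q t : 𝔤)) rfl hQ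
      (X : 𝔤)) (matAct y)
    rw [matAct_mul, matAct_mul, matAct_adMat] at h
    simpa only [Ad_mul, Ad_exp, Submodule.coe_smul, map_smul, matAct_mul, variationVelocity]
      using h

variable (D)

/-- The component along `X_{-α}` of the difference quotient in `s` of the velocity of a
variation. -/
def variationComponent (X y v : 𝔤) (α : H.root) (s t : ℝ) : ℂ :=
  killingForm ℂ 𝔤 (D.weyl.X α) (matAct (meanExp (s • y) v) (NormedSpace.exp (-(t • adMat X))))

theorem killingForm_X_variationVelocity (X y v : 𝔤) (α : H.root) (s t : ℝ) :
    killingForm ℂ 𝔤 (D.weyl.X α) (variationVelocity X y v s t) =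
      killingForm ℂ 𝔤 (D.weyl.X α) X + s * D.variationComponent X y v α s t := by
  rw [variationVelocity, map_add, variationComponent, meanExp_smul, matAct_real_smul,
    ← Complex.coe_smul, map_smul, smul_eq_mul]

theorem variationComponent_zero (X v : D.u) (y : 𝔤) (α : H.root) (t : ℝ) :
    D.variationComponent X y v α 0 t =
      killingForm ℂ 𝔤 (D.weyl.X α) (D.Ad (D.exp (-(t • X))) v) := by
  rw [variationComponent, zero_smul, meanExp_zero, Ad_exp]
  simp

theorem Ad_exp_neg (X : D.u) (t : ℝ) (y : 𝔤) :
    D.Ad (D.exp (-(t • X))) y = matAct y (NormedSpace.exp (-(t • adMat (X : 𝔤)))) := by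
  rw [Ad_exp]; simp

/-! ### Coordinates in the basis of the `A_α` and `S_α` -/

section Coordinates

variable {D}

theorem projM_eq_sum_coordinates {Z : 𝔤} (hZ : Z ∈ D.u) :
    D.projM Z = ∑ α : D.mRoots, (-(killingForm ℂ 𝔤 (D.weyl.X α) Z).re • D.A α +
      (killingForm ℂ 𝔤 (D.weyl.X α) Z).im • D.S α) := by
  rw [projM, projSum_apply, ← Finset.sum_coe_sort]
  refine Finset.sum_congr rfl fun α _ => ?_
  rw [D.proj_eq_skew hZ, skew_eq]
  simp

/-- `f A_α + g S_α` is `skew α (f + i g)`, whose pairing with `X_α` sees only the coefficient of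
`X_{-α}`. -/
theorem AreCoordinates.killingForm_eq {a : ℝ} {X : D.u} {p : ℝ → D.u} {f g : D.mRoots → ℝ → ℝ}
    (h : D.AreCoordinates a X p f g) {t : ℝ} (ht : t ∈ Icc 0 a) (α : D.mRoots) :
    killingForm ℂ 𝔤 (D.weyl.X α) (D.Ad (D.exp (-(t • X))) (p t)) =
      -starRingEnd ℂ ⟨f α t, g α t⟩ := by
  classical
  have h1 := congrArg (killingForm ℂ 𝔤 (D.weyl.X α)) (h t ht)
  rw [projM, killingForm_X_projSum subset_rfl α.2, map_sum,
    Finset.sum_eq_single_of_mem α (Finset.mem_univ _)] at h1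
  · rw [h1, ← D.skew_eq α ⟨f α t, g α t⟩, killingForm_X_skew]
    simp [(negRoot_ne_self α.1).symm]
  · intro β _ hne
    have h2 : (β : H.root) ≠ α := fun h => hne (Subtype.ext h)
    rw [← D.skew_eq β ⟨f β t, g β t⟩, killingForm_X_skew]
    simp [h2, D.ne_negRoot_of_mem_mRoots β.2 α.2]

theorem exists_areCoordinates {a : ℝ} (X : D.u) {p : ℝ → D.u} {n : ℕ∞}
    (hp : IsCnOn n p (Icc 0 a)) :
    ∃ f g : D.mRoots → ℝ → ℝ, D.AreCoordinates a X p f g ∧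
      ∀ α, ContDiffOn ℝ n (f α) (Icc 0 a) ∧ ContDiffOn ℝ n (g α) (Icc 0 a) := by
  have hs : ∀ α : D.mRoots, ContDiffOn ℝ n (fun t => killingForm ℂ 𝔤 (D.weyl.X α)
      (D.Ad (D.exp (-(t • X))) (p t))) (Icc 0 a) := by
    intro α
    refine (ContDiffOn.sum fun j _ => ContDiffOn.mul ?_ ?_).congr fun t _ =>
      (by rw [Ad_exp_neg, apply_matAct_eq_sum])
    · exact hp.linearMap ((((Module.finBasis ℂ 𝔤).coord j).restrictScalars ℝ).comp D.u.subtype)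
    · exact ((matCoeff (killingForm ℂ 𝔤 (D.weyl.X α)) (Module.finBasis ℂ 𝔤 j)).contDiff.comp
        (contDiff_exp_neg_smul (adMat (X : 𝔤)))).contDiffOn
  refine ⟨fun α t => -(killingForm ℂ 𝔤 (D.weyl.X α) (D.Ad (D.exp (-(t • X))) (p t))).re,
    fun α t => (killingForm ℂ 𝔤 (D.weyl.X α) (D.Ad (D.exp (-(t • X))) (p t))).im,
    fun t _ => projM_eq_sum_coordinates (D.Ad_mem_u _ (p t).2), fun α => ⟨?_, ?_⟩⟩
  · exact (Complex.reCLM.contDiff.comp_contDiffOn (hs α)).neg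
  · exact Complex.imCLM.contDiff.comp_contDiffOn (hs α)

end Coordinates

/-! ### Energy of the variation under a perturbation of the metric -/

variable {D}

/-- The square of the speed of a variation. -/
def variationSpeedSq (Λ : D.InvariantMetric) (X : D.u) (y v : ℝ → D.u) (s t : ℝ) : ℝ :=
  ∑ σ : D.components, Λ.coeff σ * ∑ α ∈ σ.1, 2 * Complex.normSq
    (killingForm ℂ 𝔤 (D.weyl.X α) X + s * D.variationComponent X (y t) (v t) α s t)

theorem variationEnergy_eq (Λ : D.InvariantMetric) {a : ℝ} (ha : 0 ≤ a) (X : D.u)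
    {q q' y v : ℝ → D.u} (hq : ∀ t ∈ Icc 0 a, HasCurveDerivWithinAt q (q' t) (Icc 0 a) t)
    (hy : ∀ t ∈ Icc 0 a, y t = q t) (hv : ∀ t ∈ Icc 0 a, v t = q' t) (s : ℝ) :
    Λ.variationEnergy a X q s = ∫ t in (0 : ℝ)..a, variationSpeedSq Λ X y v s t := by
  -- At the end points `q` has only one-sided derivatives, so the velocity formula is applied in the
  -- open interval, which suffices for the integral.
  refine intervalIntegral.integral_congr_Ioo_of_le ha fun t ht => ?_
  have ht' := Ioo_subset_Icc_self ht
  have hd : HasCurveDerivAt q (q' t) t := fun φ =>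
    (((hq t ht') φ).hasDerivAt (Icc_mem_nhds ht.1 ht.2)).hasDerivWithinAt
  rw [(hasVelocity_variationOf X hd s).speedSq_eq Λ,
    Λ.B_projM (variationVelocity_mem_u X.2 (q t).2 (q' t).2 s t), variationSpeedSq]
  simp only [killingForm_X_variationVelocity, hy t ht', hv t ht']

theorem isC2Family_variationComponent (X : D.u) {y v : ℝ → D.u}
    (hy : ∀ ψ : D.u →ₗ[ℝ] Mat 𝔤, Continuous fun t => ψ (y t))
    (hv : ∀ ψ : D.u →ₗ[ℝ] ℂ, Continuous fun t => ψ (v t)) (α : H.root) :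
    IsC2Family fun s t => D.variationComponent X (y t) (v t) α s t :=
  isC2Family_matAct_meanExp _ (hy (adMat.comp D.u.subtype)) (fun ψ => hv (ψ.comp D.u.subtype))
    (contDiff_exp_neg_smul (n := 0) _).continuous

theorem isC2Family_variationSpeedSq (Λ : D.InvariantMetric) (X : D.u) {y v : ℝ → D.u}
    (hy : ∀ ψ : D.u →ₗ[ℝ] Mat 𝔤, Continuous fun t => ψ (y t))
    (hv : ∀ ψ : D.u →ₗ[ℝ] ℂ, Continuous fun t => ψ (v t)) :
    IsC2Family fun s t => variationSpeedSq Λ X y v s t :=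
  IsC2Family.sum _ fun _ _ => (IsC2Family.sum _ fun α _ =>
    ((isC2Family_const continuous_const).add (isC2Family_ofReal.mul
      (isC2Family_variationComponent X hy hv α))).normSq.const_mul 2).const_mul _

/-- With the constant term `(X_α, X)` gone outside `P`, there is no part of order `0` or `1` in `s`:
the factor `s ^ 2` comes out exactly, for every `s`. -/
theorem variationSpeedSq_perturbation {P : Set D.components} {Λ Λ' : D.InvariantMetric}
    {ξ : D.components → ℝ} (hpert : IsPerturbation P Λ Λ' ξ) (X : D.u)
    (hX : ∀ σ : D.components, σ ∉ P → ∀ α ∈ σ.1, killingForm ℂ 𝔤 (D.weyl.X α) X = 0)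
    (y v : ℝ → D.u) (s t : ℝ) [DecidablePred fun σ => σ ∉ P] :
    variationSpeedSq Λ' X y v s t = variationSpeedSq Λ X y v s t +
      s ^ 2 * ∑ σ : D.components with σ ∉ P, ξ σ * ∑ α ∈ σ.1,
        2 * Complex.normSq (D.variationComponent X (y t) (v t) α s t) := by
  rw [variationSpeedSq, variationSpeedSq, Finset.sum_filter, Finset.mul_sum,
    ← Finset.sum_add_distrib]
  refine Finset.sum_congr rfl fun σ _ => ?_
  by_cases hσ : σ ∈ P
  · simp [hσ, hpert.1 σ hσ]
  · have e : ∑ α ∈ σ.1, 2 * Complex.normSq (killingForm ℂ 𝔤 (D.weyl.X α) X +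
        s * D.variationComponent X (y t) (v t) α s t) = s ^ 2 * ∑ α ∈ σ.1,
          2 * Complex.normSq (D.variationComponent X (y t) (v t) α s t) := by
      rw [Finset.mul_sum]
      refine Finset.sum_congr rfl fun α hα => ?_
      rw [hX σ hσ α hα, zero_add, map_mul, Complex.normSq_ofReal]
      ring
    rw [hpert.2 σ hσ, if_pos hσ, e]
    ring

theorem IsSubordinated.killingForm_eq_zero {P : Set D.components} {a : ℝ} {X : D.u}
    (h : D.IsSubordinated P a X) (ha : 0 ≤ a) {σ : D.components} (hσ : σ ∉ P) {α : H.root}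
    (hα : α ∈ σ.1) : killingForm ℂ 𝔤 (D.weyl.X α) X = 0 := by
  classical
  -- The velocity of `exp(tX) · o`, translated back to the origin, is `X_𝔪` at every time, so `t =
  -- 0` already gives the condition.
  have h0 := h 0 ⟨le_rfl, ha⟩ _ (hasVelocity_homCurve X 0) σ hσ α hα
  have h1 := congrArg (killingForm ℂ 𝔤 (D.weyl.X α)) h0
  rw [map_zero, proj, LinearMap.add_apply, map_add, LinearMap.smulRight_apply,
    LinearMap.smulRight_apply, map_smul, map_smul, D.weyl.killingForm_X_X, D.weyl.killingForm_X_X,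
    if_neg (negRoot_ne_self α).symm, if_pos rfl, smul_zero, zero_add, smul_eq_mul, mul_one,
    projM, killingForm_X_projSum subset_rfl (subset_mRoots_of_mem_components σ.2 hα)] at h1
  exact h1

end FlagDatum

end

end FlagPerturbation

/-! ### Comparison of the two index forms -/

open FlagPerturbation Set in
open Classical in
theorem theoremA {𝔤 : Type*} [LieRing 𝔤] [LieAlgebra ℂ 𝔤] [FiniteDimensional ℂ 𝔤]
    [LieAlgebra.IsSimple ℂ 𝔤] (H : LieSubalgebra ℂ 𝔤) [H.IsCartanSubalgebra] (D : FlagDatum H)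
    (P : Set D.components) (Λ Λ' : D.InvariantMetric) (ξ : D.components → ℝ)
    (hpert : FlagDatum.IsPerturbation P Λ Λ' ξ)
    (a : ℝ) (ha : 0 < a) (X : D.u) (hX : (X : 𝔤) ∈ D.m)
    (hsub : D.IsSubordinated P a X)
    (hgeod : Λ.IsGeodesic a (D.homCurve X)) (hgeod' : Λ'.IsGeodesic a (D.homCurve X))
    (n : ℕ∞) (q q' : ℝ → D.u)
    (hq : ∀ t ∈ Icc 0 a, HasCurveDerivWithinAt q (q' t) (Icc 0 a) t)
    (hq' : IsCnOn n q' (Icc 0 a)) :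
    ContDiffAt ℝ 2 (Λ.variationEnergy a X q) 0 ∧
    ContDiffAt ℝ 2 (Λ'.variationEnergy a X q) 0 ∧
    (∃ f g : D.mRoots → ℝ → ℝ, D.AreCoordinates a X q' f g ∧
      ∀ α, ContDiffOn ℝ n (f α) (Icc 0 a) ∧ ContDiffOn ℝ n (g α) (Icc 0 a)) ∧
    ∀ f g : D.mRoots → ℝ → ℝ, D.AreCoordinates a X q' f g →
      Λ'.indexForm a X q = Λ.indexForm a X q +
        4 * ∑ σ : D.components with σ ∉ P, ξ σ * ∑ α : σ.1,
          ∫ t in (0 : ℝ)..a,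
            ((f ⟨α, D.mem_mRoots σ α⟩ t) ^ 2 + (g ⟨α, D.mem_mRoots σ α⟩ t) ^ 2) := by
  -- Constant extension beyond `[0, a]` makes `q` and `q'` continuous on the whole line, as
  -- `IsC2Family` requires, without changing the integrals.
  let y : ℝ → D.u := fun t => q (projIcc 0 a ha.le t)
  let v : ℝ → D.u := fun t => q' (projIcc 0 a ha.le t)
  have hyq : ∀ t ∈ Icc 0 a, y t = q t := fun t ht => by simp only [y, projIcc_of_mem _ ht]
  have hvq : ∀ t ∈ Icc 0 a, v t = q' t := fun t ht => by simp only [v, projIcc_of_mem _ ht]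
  have hy : ∀ ψ : D.u →ₗ[ℝ] Mat 𝔤, Continuous fun t => ψ (y t) := fun ψ =>
    (continuousOn_iff_continuous_domRestrict.1 fun t ht =>
      ((hq t ht).linearMap ψ).continuousWithinAt).comp continuous_projIcc
  have hv : ∀ ψ : D.u →ₗ[ℝ] ℂ, Continuous fun t => ψ (v t) := fun ψ =>
    (continuousOn_iff_continuous_domRestrict.1 (hq'.linearMap ψ).continuousOn).comp continuous_projIcc
  have hcd : ∀ Λ : D.InvariantMetric, ContDiff ℝ 2 (Λ.variationEnergy a X q) := fun Λ => by
    rw [funext (FlagDatum.variationEnergy_eq Λ ha.le X hq hyq hvq)]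
    exact (FlagDatum.isC2Family_variationSpeedSq Λ X hy hv).contDiff_integral 0 a
  refine ⟨(hcd Λ).contDiffAt, (hcd Λ').contDiffAt, FlagDatum.exists_areCoordinates X hq',
    fun f g hfg => ?_⟩
  have hu := FlagDatum.isC2Family_variationComponent X hy hv
  have hR := IsC2Family.sum {σ : D.components | σ ∉ P} fun σ _ =>
    (IsC2Family.sum σ.1 fun α _ => (hu α).normSq.const_mul 2).const_mul (ξ σ)
  have hE : Λ'.variationEnergy a X q = Λ.variationEnergy a X q + fun s => s ^ 2 *
      ∫ t in (0 : ℝ)..a, ∑ σ : D.components with σ ∉ P, ξ σ * ∑ α ∈ σ.1,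
        2 * Complex.normSq (D.variationComponent X (y t) (v t) α s t) := by
    funext s
    rw [Pi.add_apply, FlagDatum.variationEnergy_eq Λ ha.le X hq hyq hvq,
      FlagDatum.variationEnergy_eq Λ' ha.le X hq hyq hvq, ← intervalIntegral.integral_const_mul,
      ← intervalIntegral.integral_add]
    · exact intervalIntegral.integral_congr fun t _ =>
        FlagDatum.variationSpeedSq_perturbation hpert X
          (fun σ hσ α hα => hsub.killingForm_eq_zero ha.le hσ hα) y v s t
    · exact ((FlagDatum.isC2Family_variationSpeedSq Λ X hy hv).continuous.uncurry_left
        s).intervalIntegrable _ _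
    · exact (continuous_const.mul (hR.continuous.uncurry_left s)).intervalIntegrable _ _
  have hRc := hR.contDiff_integral 0 a
  have hsR := (by fun_prop : ContDiff ℝ 2 fun s : ℝ => s ^ 2).mul hRc
  rw [FlagDatum.InvariantMetric.indexForm, FlagDatum.InvariantMetric.indexForm, hE,
    iteratedDeriv_add (hcd Λ).contDiffAt hsR.contDiffAt,
    iteratedDeriv_two_sq_mul hRc]
  -- What remains is `2 R(0)`: this 2 and the 2 in front of `normSq` make the factor 4.
  congr 1
  rw [intervalIntegral.integral_finsetSum fun σ _ =>
    ((IsC2Family.sum σ.1 fun α _ => (hu α).normSq.const_mul 2).const_mul (ξ σ)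
      |>.continuous.uncurry_left 0).intervalIntegrable _ _, Finset.mul_sum, Finset.mul_sum]
  refine Finset.sum_congr rfl fun σ _ => ?_
  rw [intervalIntegral.integral_const_mul, intervalIntegral.integral_finsetSum fun α _ =>
    (((hu α).normSq.const_mul 2).continuous.uncurry_left 0).intervalIntegrable _ _,
    ← Finset.sum_coe_sort, Finset.mul_sum, Finset.mul_sum, Finset.mul_sum, Finset.mul_sum]
  refine Finset.sum_congr rfl fun α _ => ?_
  rw [intervalIntegral.integral_const_mul]
  have e : ∫ t in (0 : ℝ)..a, Complex.normSq (D.variationComponent X (y t) (v t) α 0 t) =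
      ∫ t in (0 : ℝ)..a,
        ((f ⟨α, D.mem_mRoots σ α⟩ t) ^ 2 + (g ⟨α, D.mem_mRoots σ α⟩ t) ^ 2) := by
    refine intervalIntegral.integral_congr fun t ht => ?_
    rw [uIcc_of_le ha.le] at ht
    rw [FlagDatum.variationComponent_zero, hvq t ht,
      hfg.killingForm_eq ht ⟨α, D.mem_mRoots σ α⟩, Complex.normSq_neg, Complex.normSq_conj,
      Complex.normSq_mk]
    ring
  rw [e]
  ring
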